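/- **Setting.** ProBFT is a leader-based consensus protocol for $n$ replicas. A set of at most $f$ replicas, $3f<n$, fixed before the execution, is Byzantine; the others are correct. The parameters are real constants $l\ge 1$ and $o>1$, the probabilistic quorum size $q=\lceil l\sqrt n\,\rceil$ and the sample size $s=\lceil o\,q\rceil$. Signatures are ideal. An ideal verifiable random function (VRF) assigns to each replica, view and phase ("prepare" or "commit") one verifiable sample, a uniformly random set of $s$ distinct replicas, independent of all other samples; only a correct replica itself can evaluate its VRF, while the adversary can evaluate those of the faulty replicas. A predicate $\mathtt{valid}$ on values is given. **Protocol.** Views are numbered $1,2,\dots$, and view $v$ has leader $((v-1)\bmod n)+1$. A synchronizer makes a replica enter increasing views. On entering view $1$ its leader proposes its own value; on entering a view $v>1$ a replica sends the leader a signed NewLeader message for $v$ with its latest prepared view, prepared value and certificate (view $0$ and value $\bot$ if none). A NewLeader message for $v$ is valid if its prepared view is smaller than $v$ and, unless it is $0$, the certificate proves the reported value to be prepared in that view by the sender. After collecting a set $M$ of valid NewLeader messages for $v$ from at least $\lceil (n+f+1)/2\rceil$ different replicas, the leader proposes, with $M$ attached, a most frequent value among those that $M$ reports for the latest prepared view in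 $M$ (its own value if this is $\bot$). In each view a correct replica accepts at most one proposal, and only one that is *safe*: signed by the leader of the view, valid, and, if $v>1$, with an attached $M$ that entitles the leader to propose this value by the rule just stated. It then sends a Prepare message to its prepare sample. On receiving matching Prepare messages for the accepted value from $q$ different replicas whose prepare samples contain it, it *prepares* the value (those $q$ messages, if they carry the proposal signed by the leader, form its certificate) and sends a Commit message to its commit sample. On receiving matching Commit messages from $q$ different replicas whose commit samples contain it, a correct replica that has prepared the value in this view decides it. A correct replica that sees a second value signed by the leader of its current view, different from the one it has accepted, stops taking part in that view. The adversary is adaptive and may be randomized: it sees the whole history, controls the Byzantine replicas, and schedules message deliveries, view changes and all steps of correct replicas (in particular, no timing assumption is made). **Statement (main safety result).** Let $l\ge1$, $o>1$ and $\delta_0>0$ be constants. There is a function $g(n)=\Theta(\sqrt n)$, depending only on $l,o,\delta_0$, such that for all $n$ and $f$ with $3f<n$ and $$\delta:=\frac{2n}{o\,(n+f)}-1\ \ge\ \delta_0 ,$$ for every set of at most $f$ Byzantine replicas, every set of values, every predicate $\mathtt{valid}$, all initial values of the replicas, every adversary, all $a,k\in\mathbb N$ and every number of steps, the following holds with probability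 at least $1-k\,e^{-g(n)}$ after that number of steps: 1. every value decided by a correct replica is valid; 2. all decisions of correct replicas in the $k$ consecutive views $a,\dots,a+k-1$, in the same view or in different ones, are for the same value; 3. if a correct replica has decided $x$ in one of these views, then in no later one of these views can a safe proposal, all of whose signatures are genuine, be exhibited for a value other than $x$. In particular, both within a single view ($k=1$) and across a view change ($k=2$) ProBFT guarantees safety with probability at least $1-\exp(-\Theta(\sqrt n))$, uniformly in the view, and the same holds for any number $k=e^{o(\sqrt n)}$ of consecutive views (here $o(\cdot)$ is the Landau symbol). -/

import Mathlib

/-!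
The ProBFT protocol, run in an asynchronous network against a Byzantine adversary, as a discrete
probabilistic process.

* Replicas are the elements of `Fin n`; values are the elements of an arbitrary type `Val`.
* Signatures are ideal: a message part signed by a correct replica exists only if that replica
  has sent it; faulty replicas sign whatever they like.
* The verifiable random function is ideal: for each replica, view and phase it has one single
  sample, which is uniform among the sets of replicas of the prescribed size, independent of all
  other samples, and drawn the first time that it is evaluated. Only replica `i` evaluates the
  function of a correct replica `i`; the adversary may evaluate those of faulty replicas at will.
* The adversary sees the whole history, may toss coins, controls the faulty replicas and decides
  which correct replica moves next and which messages or view changes are delivered to it.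
-/

noncomputable section

namespace ProBFT

universe u

/-- The two message types that are multicast to random samples. -/
inductive Phase : Type
  | prepare
  | commit

/-- The signed pair `⟨v, x⟩_j`. -/
structure Proposal (n : ℕ) (Val : Type u) : Type u where
  view : ℕ
  val : Val
  signer : Fin n

/-- `⟨Prepare, ⟨v, x⟩_j, S, P⟩_k` or `⟨Commit, ⟨v, x⟩_j, S, P⟩_k`, according to `phase`.
The proof `P` that comes with the sample `S` is left implicit, see `State.vrfVerify`. -/
structure Vote (n : ℕ) (Val : Type u) : Type u where
  phase : Phase
  prop : Proposal n Val
  sample : Finset (Fin n)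
  sender : Fin n

/-- `⟨NewLeader, view, preparedView, preparedVal, cert⟩_sender`. -/
structure NewLeader (n : ℕ) (Val : Type u) : Type u where
  view : ℕ
  preparedView : ℕ
  preparedVal : Option Val
  cert : Finset (Vote n Val)
  sender : Fin n

/-- `⟨Propose, ⟨v, x⟩_j, M⟩_sender`. -/
structure Propose (n : ℕ) (Val : Type u) : Type u where
  prop : Proposal n Val
  just : Finset (NewLeader n Val)
  sender : Fin n

inductive Msg (n : ℕ) (Val : Type u) : Type u
  | propose (m : Propose n Val)
  | vote (w : Vote n Val)
  | newLeader (m : NewLeader n Val)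

/-- The variables of one replica. The variables `curVal`, `voted` and `proposal` of the protocol,
which are always assigned together, are kept in `proposal`: `voted` says that it is not `none`,
and `curVal` is the value in it. -/
structure LocalState (n : ℕ) (Val : Type u) : Type u where
  curView : ℕ
  proposal : Option (Propose n Val)
  blockView : Bool
  preparedView : ℕ
  preparedVal : Option Val
  cert : Finset (Vote n Val)

/-- A global state: the local states, the samples of the verifiable random function that have been
drawn so far, all messages sent so far by correct replicas, and all decisions `(i, v, x)` made so
far (correct replica `i` has decided `x` in view `v`). -/
structure State (n : ℕ) (Val : Type u) : Type u where
  loc : Fin n → LocalState n Val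
  vrf : Fin n → ℕ → Phase → Option (Finset (Fin n))
  sent : Set (Msg n Val)
  decided : Set (Fin n × ℕ × Val)

/-- The parameters of the system: fault threshold `f`, size `q` of the probabilistic quorums, size
`s` of the random samples, the predicate `valid`, the initial values of the replicas, and the set
of replicas that are actually faulty. -/
structure System (n : ℕ) (Val : Type u) : Type u where
  f : ℕ
  q : ℕ
  s : ℕ
  valid : Val → Prop
  myValue : Fin n → Val
  faulty : Finset (Fin n)

variable {n : ℕ} {Val : Type u}

/-- `j` is the leader of view `v`. Views are numbered from `1`, and leaders rotate. -/
def IsLeader (v : ℕ) (j : Fin n) : Prop := (j : ℕ) = (v - 1) % n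

/-- The size `⌈(n + f + 1) / 2⌉` of a deterministic quorum. -/
def System.detQuorum (Y : System n Val) : ℕ := (n + Y.f + 2) / 2

/-! ### Signatures -/

/-- The signature of the proposal `⟨v, x⟩_j` is genuine. -/
def System.AuthProposal (Y : System n Val) (σ : State n Val) (p : Proposal n Val) : Prop :=
  p.signer ∈ Y.faulty ∨ ∃ M, Msg.propose ⟨p, M, p.signer⟩ ∈ σ.sent

/-- All signatures in a `Prepare` or `Commit` message are genuine. -/
def System.AuthVote (Y : System n Val) (σ : State n Val) (w : Vote n Val) : Prop :=
  (w.sender ∈ Y.faulty ∨ Msg.vote w ∈ σ.sent) ∧ Y.AuthProposal σ w.prop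

/-- All signatures in a `NewLeader` message are genuine. -/
def System.AuthNewLeader (Y : System n Val) (σ : State n Val) (m : NewLeader n Val) : Prop :=
  (m.sender ∈ Y.faulty ∨ Msg.newLeader m ∈ σ.sent) ∧ ∀ w ∈ m.cert, Y.AuthVote σ w

/-- All signatures in a `Propose` message are genuine. -/
def System.AuthPropose (Y : System n Val) (σ : State n Val) (m : Propose n Val) : Prop :=
  (m.sender ∈ Y.faulty ∨ Msg.propose m ∈ σ.sent) ∧ Y.AuthProposal σ m.prop ∧
    ∀ m' ∈ m.just, Y.AuthNewLeader σ m'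

/-! ### The verifiable random function -/

/-- `S` is the sample of replica `k` for view `v` and phase `T`. -/
def State.vrfVerify (σ : State n Val) (k : Fin n) (v : ℕ) (T : Phase) (S : Finset (Fin n)) :
    Prop :=
  σ.vrf k v T = some S

/-- The uniform distribution on the sets of `s` distinct replicas (all replicas, if `n < s`). -/
def uniformSample (n s : ℕ) : PMF (Finset (Fin n)) :=
  PMF.uniformOfFinset (Finset.powersetCard (min s n) (Finset.univ : Finset (Fin n)))
    (Finset.powersetCard_nonempty.2 (by simp))

open Classical in
/-- Evaluate the function of replica `i` for view `v` and phase `T`: returns the sample, and the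
state in which it is recorded. -/
def System.vrfProve (Y : System n Val) (σ : State n Val) (i : Fin n) (v : ℕ) (T : Phase) :
    PMF (Finset (Fin n) × State n Val) :=
  match σ.vrf i v T with
  | some S => PMF.pure (S, σ)
  | none => (uniformSample n Y.s).map fun S =>
      (S, { σ with
        vrf := fun j w U => if j = i ∧ w = v ∧ U = T then some S else σ.vrf j w U })

/-! ### The predicates of the protocol -/

/-- `C` consists of messages of type `T` for the value `x` in view `v` from `q` different replicas,
each of which has `i` in its verified sample. -/
def System.IsQuorum (Y : System n Val) (σ : State n Val) (T : Phase) (C : Finset (Vote n Val))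
    (v : ℕ) (x : Val) (i : Fin n) : Prop :=
  C.card = Y.q ∧ Set.InjOn Vote.sender (C : Set (Vote n Val)) ∧
    ∀ w ∈ C, w.phase = T ∧ w.prop.view = v ∧ w.prop.val = x ∧ i ∈ w.sample ∧
      σ.vrfVerify w.sender v T w.sample

/-- `C` is a prepared certificate of replica `j` for the value `x` in view `v`. -/
def System.Prepared (Y : System n Val) (σ : State n Val) (C : Finset (Vote n Val)) (v : ℕ)
    (x : Val) (j : Fin n) : Prop :=
  Y.IsQuorum σ Phase.prepare C v x j ∧ ∀ w ∈ C, IsLeader v w.prop.signer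

def System.ValidNewLeader (Y : System n Val) (σ : State n Val) (m : NewLeader n Val) : Prop :=
  m.preparedView < m.view ∧
    (m.preparedView ≠ 0 →
      ∃ x, m.preparedVal = some x ∧ Y.Prepared σ m.cert m.preparedView x m.sender)

/-- `M` consists of valid `NewLeader` messages for view `v` from different replicas that form a
deterministic quorum. -/
def System.IsNewLeaderQuorum (Y : System n Val) (σ : State n Val) (M : Finset (NewLeader n Val))
    (v : ℕ) : Prop :=
  Y.detQuorum ≤ M.card ∧ Set.InjOn NewLeader.sender (M : Set (NewLeader n Val)) ∧
    ∀ m ∈ M, m.view = v ∧ Y.ValidNewLeader σ m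

/-- `v` is the latest prepared view that is reported in `M`. -/
def IsMaxView (M : Finset (NewLeader n Val)) (v : ℕ) : Prop :=
  (∃ m ∈ M, m.preparedView = v) ∧ ∀ m ∈ M, m.preparedView ≤ v

open Classical in
/-- How many messages in `M` report `y` as prepared in view `v`. -/
def reports (M : Finset (NewLeader n Val)) (v : ℕ) (y : Option Val) : ℕ :=
  (M.filter fun m => m.preparedView = v ∧ m.preparedVal = y).card

/-- `y` is a most frequent entry among the values that `M` reports for the latest prepared view in
`M`; the entry `none` stands for `⊥`. -/
def IsMode (M : Finset (NewLeader n Val)) (y : Option Val) : Prop :=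
  ∃ v, IsMaxView M v ∧ 0 < reports M v y ∧ ∀ z, reports M v z ≤ reports M v y

/-- A correct replica may accept the proposal in `m`. If `⊥` is the most frequent entry, then the
leader was free to propose a value of its own. -/
def System.SafeProposal (Y : System n Val) (σ : State n Val) (m : Propose n Val) : Prop :=
  1 ≤ m.prop.view ∧ m.sender = m.prop.signer ∧ IsLeader m.prop.view m.sender ∧
    Y.valid m.prop.val ∧
    (m.prop.view = 1 ∨
      (Y.IsNewLeaderQuorum σ m.just m.prop.view ∧
        (IsMode m.just (some m.prop.val) ∨ IsMode m.just none)))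

/-! ### The steps -/

/-- What the adversary can let happen in one step. A step whose precondition fails has no effect. -/
inductive Action (n : ℕ) (Val : Type u) : Type u
  /-- The synchronizer notifies replica `i` to enter view `v`. -/
  | newView (i : Fin n) (v : ℕ)
  /-- Leader `i` receives a quorum `M` of `NewLeader` messages, of which `y` is the mode. -/
  | lead (i : Fin n) (M : Finset (NewLeader n Val)) (y : Option Val)
  | receivePropose (i : Fin n) (m : Propose n Val)
  | receivePrepares (i : Fin n) (C : Finset (Vote n Val))
  | receiveCommits (i : Fin n) (C : Finset (Vote n Val))
  /-- Replica `i` receives some message that contains the signed pair `p`. -/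
  | receiveConflict (i : Fin n) (p : Proposal n Val)
  /-- The adversary evaluates the verifiable random function of the faulty replica `b`. -/
  | evalVRF (b : Fin n) (v : ℕ) (T : Phase)

open Classical in
/-- Replace the local state of `i`. -/
def State.setLoc (σ : State n Val) (i : Fin n) (L : LocalState n Val) : State n Val :=
  { σ with loc := Function.update σ.loc i L }

/-- A correct replica sends the message `m`. Any message with genuine signatures can reach any
replica, so neither the addressees nor repeated broadcasts of an old message need be recorded. -/
def State.send (σ : State n Val) (m : Msg n Val) : State n Val :=
  { σ with sent := insert m σ.sent }

open Classical in
/-- One step of the protocol. Only correct replicas, i.e. those outside `Y.faulty`, execute the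
protocol. -/
def System.step (Y : System n Val) (σ : State n Val) : Action n Val → PMF (State n Val)
  | .newView i v =>
      let L := σ.loc i
      if i ∉ Y.faulty ∧ L.curView < v then
        let σ' := σ.setLoc i { L with curView := v, proposal := none, blockView := false }
        if v = 1 then
          if IsLeader v i then PMF.pure (σ'.send (.propose ⟨⟨v, Y.myValue i, i⟩, ∅, i⟩))
          else PMF.pure σ'
        else PMF.pure (σ'.send (.newLeader ⟨v, L.preparedView, L.preparedVal, L.cert, i⟩))
      else PMF.pure σ
  | .lead i M y =>
      let v := (σ.loc i).curView
      if i ∉ Y.faulty ∧ IsLeader v i ∧ (∀ m ∈ M, Y.AuthNewLeader σ m) ∧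
          Y.IsNewLeaderQuorum σ M v ∧ IsMode M y then
        PMF.pure (σ.send (.propose ⟨⟨v, y.getD (Y.myValue i), i⟩, M, i⟩))
      else PMF.pure σ
  | .receivePropose i m =>
      let L := σ.loc i
      if i ∉ Y.faulty ∧ Y.AuthPropose σ m ∧ L.blockView = false ∧ L.curView = m.prop.view ∧
          L.proposal = none ∧ Y.SafeProposal σ m then
        (Y.vrfProve σ i L.curView .prepare).map fun r =>
          (r.2.setLoc i { L with proposal := some m }).send (.vote ⟨.prepare, m.prop, r.1, i⟩)
      else PMF.pure σ
  | .receivePrepares i C =>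
      let L := σ.loc i
      match L.proposal with
      | none => PMF.pure σ
      | some m =>
        if i ∉ Y.faulty ∧ (∀ w ∈ C, Y.AuthVote σ w) ∧ L.blockView = false ∧
            Y.IsQuorum σ .prepare C L.curView m.prop.val i then
          (Y.vrfProve σ i L.curView .commit).map fun r =>
            (r.2.setLoc i { L with
              preparedVal := some m.prop.val, preparedView := L.curView, cert := C }).send
                (.vote ⟨.commit, m.prop, r.1, i⟩)
        else PMF.pure σ
  | .receiveCommits i C =>
      let L := σ.loc i
      match L.proposal with
      | none => PMF.pure σ
      | some m =>
        if i ∉ Y.faulty ∧ (∀ w ∈ C, Y.AuthVote σ w) ∧ L.blockView = false ∧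
            L.preparedVal = some m.prop.val ∧ L.preparedView = L.curView ∧
            Y.IsQuorum σ .commit C L.curView m.prop.val i then
          PMF.pure { σ with decided := insert (i, L.curView, m.prop.val) σ.decided }
        else PMF.pure σ
  | .receiveConflict i p =>
      let L := σ.loc i
      match L.proposal with
      | none => PMF.pure σ
      | some m =>
        if i ∉ Y.faulty ∧ Y.AuthProposal σ p ∧ L.blockView = false ∧ L.curView = p.view ∧
            IsLeader p.view p.signer ∧ m.prop.val ≠ p.val then
          PMF.pure (σ.setLoc i { L with blockView := true })
        else PMF.pure σ
  | .evalVRF b v T =>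
      if b ∈ Y.faulty then (Y.vrfProve σ b v T).map Prod.snd else PMF.pure σ

/-! ### Executions -/

/-- The state in which every execution starts. -/
def State.init (n : ℕ) (Val : Type u) : State n Val where
  loc := fun _ => ⟨0, none, false, 0, none, ∅⟩
  vrf := fun _ _ _ => none
  sent := ∅
  decided := ∅

/-- A history lists the actions taken so far and the states they led to, the latest one first. -/
abbrev History (n : ℕ) (Val : Type u) : Type u := List (Action n Val × State n Val)

/-- The current state after a history. -/
def History.current : History n Val → State n Val
  | [] => State.init n Val
  | (_, σ) :: _ => σ

/-- An adversary chooses the next action, possibly at random, from the whole history. -/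
abbrev Adversary (n : ℕ) (Val : Type u) : Type u := History n Val → PMF (Action n Val)

/-- The distribution of the history after `t` steps of `Y` against the adversary `A`. -/
def System.run (Y : System n Val) (A : Adversary n Val) : ℕ → PMF (History n Val)
  | 0 => PMF.pure []
  | t + 1 => (Y.run A t).bind fun h =>
      (A h).bind fun a => (Y.step h.current a).map fun σ => (a, σ) :: h

/-! ### Safety -/

/-- It is possible to propose `y` in view `v`: there is a genuinely signed `Propose` message for
`y` in view `v` that correct replicas accept. -/
def System.Proposable (Y : System n Val) (σ : State n Val) (v : ℕ) (y : Val) : Prop :=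
  ∃ m : Propose n Val, m.prop.view = v ∧ m.prop.val = y ∧ Y.AuthPropose σ m ∧ Y.SafeProposal σ m

/-- Safety in the `k` consecutive views `a, …, a + k - 1`, up to the state `σ`. Once it fails, it
fails in all later states. -/
structure System.Safe (Y : System n Val) (a k : ℕ) (σ : State n Val) : Prop where
  /-- Correct replicas decide valid values only. -/
  validity : ∀ i v x, (i, v, x) ∈ σ.decided → Y.valid x
  /-- No two decisions, in the same view or in different ones, are different. -/
  agreement : ∀ i v x j w y, (i, v, x) ∈ σ.decided → (j, w, y) ∈ σ.decided →
    a ≤ v → v < a + k → a ≤ w → w < a + k → x = y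
  /-- After a decision, no other value can be proposed in a later view. -/
  viewChange : ∀ i v x w y, (i, v, x) ∈ σ.decided → a ≤ v → v < w → w < a + k →
    Y.Proposable σ w y → y = x

/-- The size `l√n` of a probabilistic quorum, rounded up. -/
def quorumSize (l : ℝ) (n : ℕ) : ℕ := ⌈l * √(n : ℝ)⌉₊

/-- The size `o × q` of a sample, rounded up. -/
def sampleSize (o l : ℝ) (n : ℕ) : ℕ := ⌈o * (quorumSize l n : ℝ)⌉₊

end ProBFT

end

noncomputable section

namespace ProBFT

open scoped ENNReal

universe u

variable {n : ℕ} {Val : Type u} {Y : System n Val} {σ σ' : State n Val}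

/-! ### Monotonicity -/

/-! The argument splits into a deterministic part and a probabilistic part, joined by
`LargeQuorums`: any authentic quorum for `x` that fits the samples addressed to replica `j` must be
backed by so many correct voters for `x` that, together with all faulty replicas, they exceed `(n +
f) / 2`.

Deterministic part (`System.Inv.safe`). If this holds for both phases and all receivers throughout
the window of views, probabilistic quorums behave like deterministic ones. Two values cannot both be
backed in one view, since correct replicas vote for at most one value per view (`eq_of_large`). The
correct committers of a decided value meet every quorum of `NewLeader` messages (`exists_report`),
so later leaders are tied to that value, by induction on the view (`proposable_eq`).

Probabilistic part. Fix phase, view and receiver `j`. Each drawn sample `S` gets the weight `exp (c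
* 1[j ∈ S] - d)`, with `d` such that its mean is at most `1` (`expect_weight_le_one`). If the
property fails, some set of at most `(n + f) / 2` replicas, namely the faulty ones and the voters of
one value, has at least `q` samples containing `j`, so its product of weights is huge. The adversary
chooses adaptively who votes for what, and there may be infinitely many values, so no union bound
over sets or values is available. Instead the products are summed over those values that already
have voters, and a reserve of one unit for each correct replica that has not yet voted pays for the
values that may still appear. This `potential` is a supermartingale starting at no more than `n +
1`, because the recipient value of a vote is fixed before its sample is drawn
(`expect_potential_step_le`). Markov's inequality bounds the failure for one phase, view and
receiver; a union bound over `k` views, `n` receivers and two phases completes the estimate. The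
condition on `δ` keeps the mean number of hits below `q` by a constant factor, which makes the
exponent of order `√n` (`chernoff_exponent_le`). -/

/-- `σ'` records every message and every sample that `σ` records. -/
structure State.Extends (σ σ' : State n Val) : Prop where
  sent : ∀ m, m ∈ σ.sent → m ∈ σ'.sent
  vrf : ∀ i v T S, σ.vrf i v T = some S → σ'.vrf i v T = some S

theorem System.AuthProposal.mono (h : σ.Extends σ') {p : Proposal n Val}
    (hp : Y.AuthProposal σ p) : Y.AuthProposal σ' p :=
  hp.imp_right fun ⟨M, hM⟩ => ⟨M, h.sent _ hM⟩

theorem System.AuthVote.mono (h : σ.Extends σ') {w : Vote n Val}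
    (hw : Y.AuthVote σ w) : Y.AuthVote σ' w :=
  ⟨hw.1.imp_right (h.sent _), hw.2.mono h⟩

theorem System.AuthNewLeader.mono (h : σ.Extends σ') {m : NewLeader n Val}
    (hm : Y.AuthNewLeader σ m) : Y.AuthNewLeader σ' m :=
  ⟨hm.1.imp_right (h.sent _), fun w hw => (hm.2 w hw).mono h⟩

theorem System.AuthPropose.mono (h : σ.Extends σ') {m : Propose n Val}
    (hm : Y.AuthPropose σ m) : Y.AuthPropose σ' m :=
  ⟨hm.1.imp_right (h.sent _), hm.2.1.mono h, fun m' hm' => (hm.2.2 m' hm').mono h⟩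

theorem System.IsQuorum.mono (h : σ.Extends σ') {T : Phase} {C : Finset (Vote n Val)} {v : ℕ}
    {x : Val} {i : Fin n} (hC : Y.IsQuorum σ T C v x i) : Y.IsQuorum σ' T C v x i := by
  refine ⟨hC.1, hC.2.1, fun w hw => ?_⟩
  obtain ⟨h1, h2, h3, h4, h5⟩ := hC.2.2 w hw
  exact ⟨h1, h2, h3, h4, h.vrf _ _ _ _ h5⟩

theorem System.ValidNewLeader.mono (h : σ.Extends σ') {m : NewLeader n Val}
    (hm : Y.ValidNewLeader σ m) : Y.ValidNewLeader σ' m := by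
  refine ⟨hm.1, fun h0 => ?_⟩
  obtain ⟨x, hx, hC⟩ := hm.2 h0
  exact ⟨x, hx, hC.1.mono h, hC.2⟩

theorem System.SafeProposal.mono (h : σ.Extends σ') {m : Propose n Val}
    (hm : Y.SafeProposal σ m) : Y.SafeProposal σ' m := by
  obtain ⟨h1, h2, h3, h4, h5⟩ := hm
  refine ⟨h1, h2, h3, h4, h5.imp_right fun ⟨⟨h6, h7, h8⟩, h9⟩ => ⟨⟨h6, h7, fun m' hm' => ?_⟩, h9⟩⟩
  exact ⟨(h8 m' hm').1, (h8 m' hm').2.mono h⟩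

theorem System.Proposable.mono (h : σ.Extends σ') {v : ℕ} {y : Val}
    (hy : Y.Proposable σ v y) : Y.Proposable σ' v y := by
  obtain ⟨m, h1, h2, h3, h4⟩ := hy
  exact ⟨m, h1, h2, h3.mono h, h4.mono h⟩

/-! ### Evaluations of the verifiable random function -/

open Classical in
/-- Record `S` as the sample of replica `i` for view `v` and phase `T`. -/
def State.record (σ : State n Val) (i : Fin n) (v : ℕ) (T : Phase) (S : Finset (Fin n)) :
    State n Val :=
  { σ with vrf := fun j w U => if j = i ∧ w = v ∧ U = T then some S else σ.vrf j w U }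

open Classical in
theorem State.record_eq_self {i : Fin n} {v : ℕ} {T : Phase} {S : Finset (Fin n)}
    (h : σ.vrf i v T = some S) : σ.record i v T S = σ := by
  unfold State.record
  have : (fun j w U => if j = i ∧ w = v ∧ U = T then some S else σ.vrf j w U) = σ.vrf := by
    funext j w U
    split_ifs with hc
    · obtain ⟨rfl, rfl, rfl⟩ := hc
      exact h.symm
    · rfl
  simp [this]

/-- Recording a known sample again changes nothing, so a first evaluation and a repeated one can be
treated alike as a `record`. -/
theorem System.mem_support_vrfProve {i : Fin n} {v : ℕ} {T : Phase}
    {r : Finset (Fin n) × State n Val} (hr : r ∈ (Y.vrfProve σ i v T).support) :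
    (σ.vrf i v T = none ∨ σ.vrf i v T = some r.1) ∧ r.2 = σ.record i v T r.1 := by
  unfold System.vrfProve at hr
  split at hr
  · rename_i S hS
    rw [PMF.support_pure, Set.mem_singleton_iff] at hr
    subst hr
    exact ⟨Or.inr hS, (State.record_eq_self hS).symm⟩
  · rename_i hS
    rw [PMF.support_map] at hr
    obtain ⟨S, -, rfl⟩ := hr
    exact ⟨Or.inl hS, rfl⟩

theorem State.extends_record {i : Fin n} {v : ℕ} {T : Phase} {S : Finset (Fin n)}
    (h : σ.vrf i v T = none ∨ σ.vrf i v T = some S) : σ.Extends (σ.record i v T S) := by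
  refine ⟨fun m hm => hm, fun j w U R hR => ?_⟩
  unfold State.record
  dsimp only
  split_ifs with hc
  · obtain ⟨rfl, rfl, rfl⟩ := hc
    rcases h with h | h
    · simp [h] at hR
    · rw [← h, hR]
  · exact hR

theorem State.record_self {i : Fin n} {v : ℕ} {T : Phase} {S : Finset (Fin n)} :
    (σ.record i v T S).vrf i v T = some S := by
  simp [State.record]

/-! ### Invariants -/

/-- The facts about reachable states from which safety is derived. -/
structure System.Inv (Y : System n Val) (σ : State n Val) : Prop where
  proposal : ∀ i m, (σ.loc i).proposal = some m → m.prop.view = (σ.loc i).curView ∧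
    ∃ S, Msg.vote ⟨.prepare, m.prop, S, i⟩ ∈ σ.sent
  correct : ∀ w, Msg.vote w ∈ σ.sent → w.sender ∉ Y.faulty
  vrf_eq : ∀ w, Msg.vote w ∈ σ.sent → σ.vrf w.sender w.prop.view w.phase = some w.sample
  view_le : ∀ w, Msg.vote w ∈ σ.sent → w.prop.view ≤ (σ.loc w.sender).curView
  current : ∀ w, Msg.vote w ∈ σ.sent → w.prop.view = (σ.loc w.sender).curView →
    ∃ m, (σ.loc w.sender).proposal = some m ∧ m.prop = w.prop
  unique : ∀ w w', Msg.vote w ∈ σ.sent → Msg.vote w' ∈ σ.sent → w.sender = w'.sender →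
    w.prop.view = w'.prop.view → w.prop = w'.prop
  commit : ∀ w, Msg.vote w ∈ σ.sent → w.phase = .commit →
    (∃ S, Msg.vote ⟨.prepare, w.prop, S, w.sender⟩ ∈ σ.sent) ∧
      w.prop.view ≤ (σ.loc w.sender).preparedView
  -- A correct replica evaluates its function only when it votes, so the adversary never sees its
  -- sample before its choice of value is fixed.
  drawn : ∀ i v T S, i ∉ Y.faulty → σ.vrf i v T = some S →
    ∃ p : Proposal n Val, p.view = v ∧ Msg.vote ⟨T, p, S, i⟩ ∈ σ.sent
  -- The link between views: a correct replica cannot hide an earlier commit in its later reports.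
  newLeader : ∀ m, Msg.newLeader m ∈ σ.sent → m.view ≤ (σ.loc m.sender).curView ∧
    ∀ w, Msg.vote w ∈ σ.sent → w.phase = .commit → w.sender = m.sender →
      w.prop.view < m.view → w.prop.view ≤ m.preparedView
  proposable : ∀ w, Msg.vote w ∈ σ.sent → Y.Proposable σ w.prop.view w.prop.val
  decided : ∀ i v x, (i, v, x) ∈ σ.decided → Y.Proposable σ v x ∧
    ∃ C, (∀ w ∈ C, Y.AuthVote σ w) ∧ Y.IsQuorum σ .commit C v x i

theorem System.inv_init (Y : System n Val) : Y.Inv (State.init n Val) := by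
  constructor <;> simp [State.init]

/-- A step that neither moves a replica to another view, nor produces a vote or a decision. -/
theorem System.Inv.of_same (hI : Y.Inv σ)
    (hsent : ∀ m, m ∈ σ.sent → m ∈ σ'.sent)
    (hvote : ∀ w, Msg.vote w ∈ σ'.sent → Msg.vote w ∈ σ.sent)
    (hlead : ∀ m, Msg.newLeader m ∈ σ'.sent → Msg.newLeader m ∈ σ.sent)
    (hvrf : ∀ i v T S, σ.vrf i v T = some S → σ'.vrf i v T = some S)
    (hvrf' : ∀ i v T S, i ∉ Y.faulty → σ'.vrf i v T = some S → σ.vrf i v T = some S)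
    (hprop : ∀ i, (σ'.loc i).proposal = (σ.loc i).proposal)
    (hview : ∀ i, (σ'.loc i).curView = (σ.loc i).curView)
    (hprep : ∀ i, (σ'.loc i).preparedView = (σ.loc i).preparedView)
    (hdec : ∀ i v x, (i, v, x) ∈ σ'.decided → (i, v, x) ∈ σ.decided ∨ (Y.Proposable σ v x ∧
      ∃ C, (∀ w ∈ C, Y.AuthVote σ w) ∧ Y.IsQuorum σ .commit C v x i)) : Y.Inv σ' := by
  have hE : σ.Extends σ' := ⟨hsent, hvrf⟩
  constructor
  · intro i m hm
    rw [hprop] at hm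
    obtain ⟨h1, S, h2⟩ := hI.proposal i m hm
    exact ⟨by rw [hview, h1], S, hsent _ h2⟩
  · exact fun w hw => hI.correct w (hvote w hw)
  · exact fun w hw => hvrf _ _ _ _ (hI.vrf_eq w (hvote w hw))
  · exact fun w hw => by rw [hview]; exact hI.view_le w (hvote w hw)
  · intro w hw h
    rw [hview] at h
    rw [hprop]
    exact hI.current w (hvote w hw) h
  · exact fun w w' hw hw' => hI.unique w w' (hvote w hw) (hvote w' hw')
  · intro w hw h
    obtain ⟨⟨S, hS⟩, h1⟩ := hI.commit w (hvote w hw) h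
    exact ⟨⟨S, hsent _ hS⟩, by rw [hprep]; exact h1⟩
  · intro i v T S hi hS
    obtain ⟨p, hp, h⟩ := hI.drawn i v T S hi (hvrf' i v T S hi hS)
    exact ⟨p, hp, hsent _ h⟩
  · intro m hm
    obtain ⟨h1, h2⟩ := hI.newLeader m (hlead m hm)
    exact ⟨by rw [hview]; exact h1, fun w hw => h2 w (hvote w hw)⟩
  · exact fun w hw => (hI.proposable w (hvote w hw)).mono hE
  · intro i v x h
    have : Y.Proposable σ v x ∧
        ∃ C, (∀ w ∈ C, Y.AuthVote σ w) ∧ Y.IsQuorum σ .commit C v x i :=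
      (hdec i v x h).elim (hI.decided i v x) id
    obtain ⟨h1, C, h2, h3⟩ := this
    exact ⟨h1.mono hE, C, fun w hw => (h2 w hw).mono hE, h3.mono hE⟩

/-- A correct replica enters a new view. -/
theorem System.Inv.of_newView (hI : Y.Inv σ) {i : Fin n} {v : ℕ}
    (hsent : ∀ m, m ∈ σ.sent → m ∈ σ'.sent)
    (hvote : ∀ w, Msg.vote w ∈ σ'.sent → Msg.vote w ∈ σ.sent)
    (hlead : ∀ m, Msg.newLeader m ∈ σ'.sent → Msg.newLeader m ∈ σ.sent ∨
      m.sender = i ∧ m.view = v ∧ m.preparedView = (σ.loc i).preparedView)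
    (hvrf : σ'.vrf = σ.vrf) (hdec : σ'.decided = σ.decided)
    (hlt : (σ.loc i).curView < v)
    (hloc : ∀ j, j ≠ i → σ'.loc j = σ.loc j)
    (hprop : (σ'.loc i).proposal = none)
    (hview : (σ'.loc i).curView = v)
    (hprep : (σ'.loc i).preparedView = (σ.loc i).preparedView) : Y.Inv σ' := by
  have hE : σ.Extends σ' := ⟨hsent, by simp [hvrf]⟩
  have hprep' : ∀ j, (σ'.loc j).preparedView = (σ.loc j).preparedView := fun j => by
    by_cases hj : j = i
    · rw [hj, hprep]
    · rw [hloc j hj]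
  have hview' : ∀ j, (σ.loc j).curView ≤ (σ'.loc j).curView := fun j => by
    by_cases hj : j = i
    · rw [hj, hview]; exact hlt.le
    · rw [hloc j hj]
  constructor
  · intro j m hm
    by_cases hj : j = i
    · rw [hj, hprop] at hm; cases hm
    · rw [hloc j hj] at hm ⊢
      obtain ⟨h1, S, h2⟩ := hI.proposal j m hm
      exact ⟨h1, S, hsent _ h2⟩
  · exact fun w hw => hI.correct w (hvote w hw)
  · exact fun w hw => by rw [hvrf]; exact hI.vrf_eq w (hvote w hw)
  · exact fun w hw => (hI.view_le w (hvote w hw)).trans (hview' _)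
  · intro w hw h
    by_cases hj : w.sender = i
    -- The replica has not voted in the view it is only now entering.
    · have := hI.view_le w (hvote w hw)
      rw [hj, hview] at h
      rw [hj] at this
      omega
    · rw [hloc _ hj] at h ⊢
      exact hI.current w (hvote w hw) h
  · exact fun w w' hw hw' => hI.unique w w' (hvote w hw) (hvote w' hw')
  · intro w hw h
    obtain ⟨⟨S, hS⟩, h1⟩ := hI.commit w (hvote w hw) h
    exact ⟨⟨S, hsent _ hS⟩, by rw [hprep']; exact h1⟩
  · intro j w T S hj hS
    rw [hvrf] at hS
    obtain ⟨p, hp, h⟩ := hI.drawn j w T S hj hS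
    exact ⟨p, hp, hsent _ h⟩
  · intro m hm
    rcases hlead m hm with hm | ⟨h1, h2, h3⟩
    · obtain ⟨h1, h2⟩ := hI.newLeader m hm
      exact ⟨h1.trans (hview' _), fun w hw => h2 w (hvote w hw)⟩
    · refine ⟨by rw [h1, h2, hview], fun w hw hT hs _ => ?_⟩
      rw [h3, ← h1, ← hs]
      exact (hI.commit w (hvote w hw) hT).2
  · exact fun w hw => (hI.proposable w (hvote w hw)).mono hE
  · intro j w x h
    rw [hdec] at h
    obtain ⟨h1, C, h2, h3⟩ := hI.decided j w x h
    exact ⟨h1.mono hE, C, fun w hw => (h2 w hw).mono hE, h3.mono hE⟩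

/-- A correct replica votes for the proposal of its current view. -/
theorem System.Inv.of_vote (hI : Y.Inv σ) {i : Fin n} {T : Phase} {S : Finset (Fin n)}
    {m : Propose n Val} (hi : i ∉ Y.faulty)
    (hnone : σ.vrf i (σ.loc i).curView T = none ∨ σ.vrf i (σ.loc i).curView T = some S)
    (hsent : σ'.sent = insert (Msg.vote ⟨T, m.prop, S, i⟩) σ.sent)
    (hvrf : σ'.vrf = (σ.record i (σ.loc i).curView T S).vrf)
    (hdec : σ'.decided = σ.decided)
    (hloc : ∀ j, j ≠ i → σ'.loc j = σ.loc j)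
    (hprop : (σ'.loc i).proposal = some m)
    (hview : (σ'.loc i).curView = (σ.loc i).curView)
    (hmview : m.prop.view = (σ.loc i).curView)
    (hold : (σ.loc i).proposal = none ∨ (σ.loc i).proposal = some m)
    (hprepare : ∃ S', Msg.vote ⟨.prepare, m.prop, S', i⟩ ∈ σ'.sent)
    (hprep : T = .prepare ∧ (σ'.loc i).preparedView = (σ.loc i).preparedView ∨
      T = .commit ∧ (σ'.loc i).preparedView = (σ.loc i).curView)
    (hable : Y.Proposable σ m.prop.view m.prop.val) : Y.Inv σ' := by
  have hE : σ.Extends σ' :=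
    ⟨fun m hm => by rw [hsent]; exact Set.mem_insert_of_mem _ hm,
      by rw [hvrf]; exact (State.extends_record hnone).vrf⟩
  have hvote : ∀ w, Msg.vote w ∈ σ'.sent → w = ⟨T, m.prop, S, i⟩ ∨ Msg.vote w ∈ σ.sent := by
    intro w hw
    rw [hsent] at hw
    exact hw.imp_left fun h => by injection h
  have hview' : ∀ j, (σ'.loc j).curView = (σ.loc j).curView := fun j => by
    by_cases hj : j = i
    · rw [hj, hview]
    · rw [hloc j hj]
  -- An earlier vote of `i` in its current view forces a recorded proposal, which can only be `m`;
  -- this is what prevents double voting.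
  have hown : ∀ w, Msg.vote w ∈ σ.sent → w.sender = i → w.prop.view = m.prop.view →
      w.prop = m.prop := by
    intro w hw h1 h2
    obtain ⟨m', h3, h4⟩ := hI.current w hw (by rw [h2, hmview, h1])
    rw [h1] at h3
    rcases hold with h | h
    · rw [h] at h3; cases h3
    · rw [h] at h3
      injection h3 with h3
      rw [← h4, h3]
  constructor
  · intro j m' hm'
    by_cases hj : j = i
    · subst hj
      rw [hprop] at hm'
      injection hm' with hm'
      subst hm'
      exact ⟨by rw [hmview, hview], hprepare⟩
    · rw [hloc j hj] at hm' ⊢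
      obtain ⟨h1, S, h2⟩ := hI.proposal j m' hm'
      exact ⟨h1, S, hE.sent _ h2⟩
  · intro w hw
    rcases hvote w hw with rfl | hw
    · exact hi
    · exact hI.correct w hw
  · intro w hw
    rcases hvote w hw with rfl | hw
    · rw [hvrf]
      dsimp only
      rw [hmview]
      exact State.record_self
    · exact hE.vrf _ _ _ _ (hI.vrf_eq w hw)
  · intro w hw
    rw [hview']
    rcases hvote w hw with rfl | hw
    · exact hmview.le
    · exact hI.view_le w hw
  · intro w hw h
    rcases hvote w hw with rfl | hw
    · exact ⟨m, hprop, rfl⟩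
    · rw [hview'] at h
      by_cases hj : w.sender = i
      · rw [hj] at h ⊢
        exact ⟨m, hprop, (hown w hw hj (h.trans hmview.symm)).symm⟩
      · rw [hloc _ hj]
        exact hI.current w hw h
  · intro w w' hw hw' h1 h2
    rcases hvote w hw with rfl | hw <;> rcases hvote w' hw' with rfl | hw'
    · rfl
    · exact (hown w' hw' h1.symm h2.symm).symm
    · exact hown w hw h1 h2
    · exact hI.unique w w' hw hw' h1 h2
  · intro w hw hT
    rcases hvote w hw with rfl | hw
    · refine ⟨hprepare, ?_⟩
      dsimp only at hT ⊢
      rcases hprep with ⟨h, -⟩ | ⟨-, h⟩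
      · rw [h] at hT; cases hT
      · rw [h, hmview]
    · obtain ⟨⟨S', hS⟩, h1⟩ := hI.commit w hw hT
      refine ⟨⟨S', hE.sent _ hS⟩, ?_⟩
      by_cases hj : w.sender = i
      · rw [hj] at h1 ⊢
        rcases hprep with ⟨-, h⟩ | ⟨-, h⟩
        · rw [h]; exact h1
        · rw [h, ← hj]; exact hI.view_le w hw
      · rw [hloc _ hj]; exact h1
  · intro j v U R hj hR
    rw [hvrf] at hR
    unfold State.record at hR
    dsimp only at hR
    split_ifs at hR with hc
    · obtain ⟨rfl, rfl, rfl⟩ := hc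
      injection hR with hR
      subst hR
      exact ⟨m.prop, hmview, by rw [hsent]; exact Set.mem_insert _ _⟩
    · obtain ⟨p, hp, h⟩ := hI.drawn j v U R hj hR
      exact ⟨p, hp, hE.sent _ h⟩
  · intro m' hm'
    rw [hsent] at hm'
    have hm' : Msg.newLeader m' ∈ σ.sent := hm'.resolve_left (by simp)
    obtain ⟨h1, h2⟩ := hI.newLeader m' hm'
    refine ⟨by rw [hview']; exact h1, fun w hw hT hs hlt => ?_⟩
    rcases hvote w hw with rfl | hw
    -- The new vote lies in the current view of its sender, which is at least the view of any
    -- `NewLeader` message already sent by it, so `hlt` is impossible.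
    · dsimp only at hs hlt
      rw [← hs] at h1
      omega
    · exact h2 w hw hT hs hlt
  · intro w hw
    rcases hvote w hw with rfl | hw
    · exact hable.mono hE
    · exact (hI.proposable w hw).mono hE
  · intro j w x h
    rw [hdec] at h
    obtain ⟨h1, C, h2, h3⟩ := hI.decided j w x h
    exact ⟨h1.mono hE, C, fun w hw => (h2 w hw).mono hE, h3.mono hE⟩

theorem System.Inv.step (hI : Y.Inv σ) (a : Action n Val)
    (h : σ' ∈ (Y.step σ a).support) : Y.Inv σ' := by
  cases a with
  | newView i v =>
    simp only [System.step] at h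
    split_ifs at h with h1 h2 h3 <;> rw [PMF.support_pure, Set.mem_singleton_iff] at h <;> subst h
    · refine hI.of_newView (i := i) (v := v) ?_ ?_ ?_ rfl rfl h1.2 ?_ ?_ ?_ ?_ <;>
        simp +contextual [State.send, State.setLoc]
    · refine hI.of_newView (i := i) (v := v) ?_ ?_ ?_ rfl rfl h1.2 ?_ ?_ ?_ ?_ <;>
        simp +contextual [State.setLoc]
    · refine hI.of_newView (i := i) (v := v) ?_ ?_ ?_ rfl rfl h1.2 ?_ ?_ ?_ ?_ <;>
        simp +contextual [State.send, State.setLoc]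
    · exact hI
  | lead i M y =>
    simp only [System.step] at h
    split_ifs at h with h1 <;> rw [PMF.support_pure, Set.mem_singleton_iff] at h <;> subst h
    · refine hI.of_same ?_ ?_ ?_ ?_ ?_ ?_ ?_ ?_ ?_ <;> simp +contextual [State.send]
    · exact hI
  | receivePropose i m =>
    simp only [System.step] at h
    split_ifs at h with h1
    · rw [PMF.support_map] at h
      obtain ⟨r, hr, rfl⟩ := h
      obtain ⟨hS, hr2⟩ := System.mem_support_vrfProve hr
      obtain ⟨h2, h3, h4, h5, h6, h7⟩ := h1
      refine hI.of_vote (i := i) (T := .prepare) (S := r.1) (m := m) h2 hS ?_ ?_ ?_ ?_ ?_ ?_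
        h5.symm (Or.inl h6) ⟨r.1, ?_⟩ (Or.inl ⟨rfl, ?_⟩) ⟨m, rfl, rfl, h3, h7⟩ <;>
        simp +contextual [State.send, State.setLoc, hr2, State.record]
    · rw [PMF.support_pure, Set.mem_singleton_iff] at h
      subst h
      exact hI
  | receivePrepares i C =>
    simp only [System.step] at h
    split at h
    · rw [PMF.support_pure, Set.mem_singleton_iff] at h
      subst h
      exact hI
    · rename_i m hm
      split_ifs at h with h1
      · rw [PMF.support_map] at h
        obtain ⟨r, hr, rfl⟩ := h
        obtain ⟨hS, hr2⟩ := System.mem_support_vrfProve hr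
        obtain ⟨h2, h3, h4, h5⟩ := h1
        obtain ⟨h6, S', h7⟩ := hI.proposal i m hm
        refine hI.of_vote (i := i) (T := .commit) (S := r.1) (m := m) h2 hS ?_ ?_ ?_ ?_ ?_ ?_
          h6 (Or.inr hm) ⟨S', ?_⟩ (Or.inr ⟨rfl, ?_⟩) (hI.proposable _ h7) <;>
          simp +contextual [State.send, State.setLoc, hr2, State.record, hm, h7]
      · rw [PMF.support_pure, Set.mem_singleton_iff] at h
        subst h
        exact hI
  | receiveCommits i C =>
    simp only [System.step] at h
    split at h
    · rw [PMF.support_pure, Set.mem_singleton_iff] at h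
      subst h
      exact hI
    · rename_i m hm
      split_ifs at h with h1 <;> rw [PMF.support_pure, Set.mem_singleton_iff] at h <;> subst h
      · obtain ⟨h2, h3, h4, h5, h6, h7⟩ := h1
        obtain ⟨h8, S', h9⟩ := hI.proposal i m hm
        refine hI.of_same (fun _ h => h) (fun _ h => h) (fun _ h => h) (fun _ _ _ _ h => h)
          (fun _ _ _ _ _ h => h) (fun _ => rfl) (fun _ => rfl) (fun _ => rfl) ?_
        intro j v x hd
        rcases hd with hd | hd
        · simp only [Prod.mk.injEq] at hd
          obtain ⟨rfl, rfl, rfl⟩ := hd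
          refine Or.inr ⟨?_, C, h3, h7⟩
          rw [← h8]
          exact hI.proposable _ h9
        · exact Or.inl hd
      · exact hI
  | receiveConflict i p =>
    simp only [System.step] at h
    split at h
    · rw [PMF.support_pure, Set.mem_singleton_iff] at h
      subst h
      exact hI
    · rename_i m hm
      split_ifs at h with h1 <;> rw [PMF.support_pure, Set.mem_singleton_iff] at h <;> subst h
      · refine hI.of_same (fun _ h => h) (fun _ h => h) (fun _ h => h) (fun _ _ _ _ h => h)
          (fun _ _ _ _ _ h => h) ?_ ?_ ?_ (fun _ _ _ h => Or.inl h) <;>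
        · intro j
          by_cases hj : j = i
          · subst hj; simp [State.setLoc]
          · simp [State.setLoc, hj]
      · exact hI
  | evalVRF b v T =>
    simp only [System.step] at h
    split_ifs at h with h1
    · rw [PMF.support_map] at h
      obtain ⟨r, hr, rfl⟩ := h
      obtain ⟨hS, hr2⟩ := System.mem_support_vrfProve hr
      rw [hr2]
      refine hI.of_same (fun _ h => h) (fun _ h => h) (fun _ h => h)
        (State.extends_record hS).vrf ?_ (fun _ => rfl) (fun _ => rfl) (fun _ => rfl)
        (fun _ _ _ h => Or.inl h)
      intro i w U S hi hS
      unfold State.record at hS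
      dsimp only at hS
      rwa [if_neg] at hS
      rintro ⟨rfl, -, -⟩
      exact hi h1
    · rw [PMF.support_pure, Set.mem_singleton_iff] at h
      subst h
      exact hI

theorem System.Inv.of_mem_support_run {A : Adversary n Val} {t : ℕ} {h : History n Val}
    (hh : h ∈ (Y.run A t).support) : Y.Inv h.current := by
  induction t generalizing h with
  | zero =>
    simp only [System.run, PMF.support_pure, Set.mem_singleton_iff] at hh
    subst hh
    exact Y.inv_init
  | succ t ih =>
    simp only [System.run, PMF.support_bind, PMF.support_map, Set.mem_iUnion] at hh
    obtain ⟨h', hh', a, -, σ, hσ, rfl⟩ := hh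
    exact (ih hh').step a hσ

/-! ### Safety from large quorums -/

open Classical in
/-- The replicas that have sent a vote of type `T` for `x` in view `v`. -/
def State.voters (σ : State n Val) (T : Phase) (v : ℕ) (x : Val) : Finset (Fin n) :=
  {i | ∃ (p : Proposal n Val) (S : Finset (Fin n)),
    p.view = v ∧ p.val = x ∧ Msg.vote ⟨T, p, S, i⟩ ∈ σ.sent}

theorem State.mem_voters {T : Phase} {v : ℕ} {x : Val} {i : Fin n} :
    i ∈ σ.voters T v x ↔ ∃ (p : Proposal n Val) (S : Finset (Fin n)),
      p.view = v ∧ p.val = x ∧ Msg.vote ⟨T, p, S, i⟩ ∈ σ.sent := by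
  simp [State.voters]

theorem System.Inv.voters_correct (hI : Y.Inv σ) {T : Phase} {v : ℕ} {x : Val} {i : Fin n}
    (hi : i ∈ σ.voters T v x) : i ∉ Y.faulty := by
  obtain ⟨p, S, -, -, h⟩ := State.mem_voters.1 hi
  exact hI.correct _ h

theorem System.Inv.voters_unique (hI : Y.Inv σ) {T U : Phase} {v : ℕ} {x y : Val} {i : Fin n}
    (hi : i ∈ σ.voters T v x) (hi' : i ∈ σ.voters U v y) : x = y := by
  obtain ⟨p, S, h1, rfl, h⟩ := State.mem_voters.1 hi
  obtain ⟨p', S', h1', rfl, h'⟩ := State.mem_voters.1 hi'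
  exact congrArg _ (hI.unique _ _ h h' rfl (h1.trans h1'.symm))

theorem System.Inv.voters_proposable (hI : Y.Inv σ) {T : Phase} {v : ℕ} {x : Val} {i : Fin n}
    (hi : i ∈ σ.voters T v x) : Y.Proposable σ v x := by
  obtain ⟨p, S, rfl, rfl, h⟩ := State.mem_voters.1 hi
  exact hI.proposable _ h

theorem System.Inv.voters_commit_subset (hI : Y.Inv σ) {v : ℕ} {x : Val} :
    σ.voters .commit v x ⊆ σ.voters .prepare v x := by
  intro i hi
  obtain ⟨p, S, h1, h2, h⟩ := State.mem_voters.1 hi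
  obtain ⟨S', hS⟩ := (hI.commit _ h rfl).1
  exact State.mem_voters.2 ⟨p, S', h1, h2, hS⟩

/-- In view `v`, every authentic quorum for a value that replica `j` can receive in phase `T`
reveals that many correct replicas have voted for this value. -/
def System.LargeQuorums (Y : System n Val) (σ : State n Val) (T : Phase) (v : ℕ) (j : Fin n) :
    Prop :=
  ∀ x C, (∀ w ∈ C, Y.AuthVote σ w) → Y.IsQuorum σ T C v x j →
    n + Y.f < 2 * ((σ.voters T v x).card + Y.faulty.card)

theorem System.Inv.card_voters_add_le (hI : Y.Inv σ) {T : Phase} {v : ℕ} {x : Val}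
    {D : Finset (Fin n)} (hD : Disjoint D (σ.voters T v x)) (hD' : Disjoint D Y.faulty) :
    D.card + (σ.voters T v x).card + Y.faulty.card ≤ n := by
  have h : Disjoint (D ∪ σ.voters T v x) Y.faulty := by
    rw [Finset.disjoint_union_left]
    exact ⟨hD', Finset.disjoint_left.2 fun i hi => hI.voters_correct hi⟩
  have := Finset.card_le_univ ((D ∪ σ.voters T v x) ∪ Y.faulty)
  rwa [Finset.card_union_of_disjoint h, Finset.card_union_of_disjoint hD, Fintype.card_fin] at this

/-- Otherwise the two voter sets and the faulty set are pairwise disjoint, with at most `n` elements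
in all. Adding the two bounds counts the faulty set twice and gives at least `n + f + 1`, hence more
than `f` faulty replicas. -/
theorem System.Inv.eq_of_large (hI : Y.Inv σ) (hf : Y.faulty.card ≤ Y.f) {T : Phase} {v : ℕ}
    {x y : Val} (hx : n + Y.f < 2 * ((σ.voters T v x).card + Y.faulty.card))
    (hy : n + Y.f < 2 * ((σ.voters T v y).card + Y.faulty.card)) : x = y := by
  by_contra hne
  have h1 : Disjoint (σ.voters T v x) (σ.voters T v y) :=
    Finset.disjoint_left.2 fun i hi hi' => hne (hI.voters_unique hi hi')
  have h2 : Disjoint (σ.voters T v x) Y.faulty :=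
    Finset.disjoint_left.2 fun i hi => hI.voters_correct hi
  have := hI.card_voters_add_le h1 h2
  omega

theorem System.exists_voter_of_large (hf : Y.faulty.card ≤ Y.f) (hn : 3 * Y.f < n) {T : Phase}
    {v : ℕ} {x : Val} (hx : n + Y.f < 2 * ((σ.voters T v x).card + Y.faulty.card)) :
    ∃ i, i ∈ σ.voters T v x := by
  refine Finset.card_pos.1 ?_
  omega

/-- Counting makes some correct sender in `M` a committer of view `v`. It prepared in view `v`
before it reported for `w`, so its report is at least `v`. -/
theorem System.Inv.exists_report (hI : Y.Inv σ) (hf : Y.faulty.card ≤ Y.f) {v w : ℕ} {x : Val}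
    (hx : n + Y.f < 2 * ((σ.voters .commit v x).card + Y.faulty.card)) (hvw : v < w)
    {M : Finset (NewLeader n Val)} (hauth : ∀ m ∈ M, Y.AuthNewLeader σ m)
    (hM : Y.IsNewLeaderQuorum σ M w) : ∃ m ∈ M, v ≤ m.preparedView := by
  classical
  obtain ⟨h1, h2, h3⟩ := hM
  by_contra! hcon
  have hD : Disjoint (M.image NewLeader.sender \ Y.faulty) (σ.voters .commit v x) := by
    rw [Finset.disjoint_left]
    intro i hi hi'
    obtain ⟨hi, hc⟩ := Finset.mem_sdiff.1 hi
    obtain ⟨m, hm, rfl⟩ := Finset.mem_image.1 hi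
    obtain ⟨p, S, hp, -, hS⟩ := State.mem_voters.1 hi'
    have h4 := (hauth m hm).1.resolve_left hc
    have h5 := (hI.newLeader m h4).2 _ hS rfl rfl (by rw [(h3 m hm).1]; exact hp.trans_lt hvw)
    have h6 := hcon m hm
    dsimp only at h5
    omega
  have h4 := hI.card_voters_add_le hD Finset.sdiff_disjoint
  have h5 := Finset.le_card_sdiff Y.faulty (M.image NewLeader.sender)
  rw [Finset.card_image_of_injOn h2] at h5
  unfold System.detQuorum at h1
  omega

-- Strong induction on the later view. The latest view `u` reported in the justification is at least
-- `v`. A mode is carried by an actual report with a certificate for `u`: if `u = v`, its voters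
-- clash with the committers of `x` unless the values agree; if `u > v`, some correct replica voted
-- for the certified value, which was therefore proposable in `u`, and the induction hypothesis
-- applies.
open Classical in
theorem System.Inv.proposable_eq (hI : Y.Inv σ) (hf : Y.faulty.card ≤ Y.f) (hn : 3 * Y.f < n)
    {v b : ℕ} {x : Val} (hv : 1 ≤ v)
    (hx : n + Y.f < 2 * ((σ.voters .commit v x).card + Y.faulty.card))
    (hL : ∀ w, v ≤ w → w < b → ∀ j, Y.LargeQuorums σ .prepare w j) :
    ∀ w, v < w → w < b → ∀ y, Y.Proposable σ w y → y = x := by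
  intro w
  induction w using Nat.strong_induction_on with
  | _ w ih =>
  intro hvw hwb y hy
  obtain ⟨m, rfl, rfl, ⟨-, -, hauth⟩, h1, -, -, -, h2⟩ := hy
  obtain ⟨hM, hmode⟩ := h2.resolve_left (by omega)
  obtain ⟨m₁, hm₁, hv₁⟩ := hI.exists_report hf hx hvw hauth hM
  -- Stated for optional values, so that it also excludes the mode `none`, under which the leader
  -- could choose freely.
  have key : ∀ z, IsMode m.just z → z = some x := by
    rintro z ⟨u, ⟨-, hmax⟩, hpos, -⟩
    obtain ⟨m₂, hr⟩ := Finset.card_pos.1 hpos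
    obtain ⟨hm₂, rfl, rfl⟩ := Finset.mem_filter.1 hr
    have hvu := hv₁.trans (hmax m₁ hm₁)
    obtain ⟨hview, hlt, hval⟩ := hM.2.2 m₂ hm₂
    obtain ⟨y', hy', hC, -⟩ := hval (by omega)
    -- The certificate is a quorum addressed to the reporter, who may be faulty; hence large quorums
    -- are needed for every receiver, not only for correct ones.
    have hlarge := hL m₂.preparedView hvu (by omega) m₂.sender y' m₂.cert (hauth m₂ hm₂).2 hC
    rw [hy']
    congr 1
    rcases hvu.eq_or_lt with he | hgt
    · rw [← he] at hlarge
      refine hI.eq_of_large hf hlarge ?_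
      have := Finset.card_le_card (hI.voters_commit_subset (v := v) (x := x))
      omega
    · obtain ⟨i, hi⟩ := System.exists_voter_of_large hf hn hlarge
      exact ih _ (by omega) hgt (by omega) y' (hI.voters_proposable hi)
  rcases hmode with h | h
  · exact Option.some_injective _ (key _ h)
  · cases key _ h

/-- Decided values are proposable in their view. Thus agreement across views is a case of the
view-change property, and validity is part of the safety of the proposal. -/
theorem System.Inv.safe (hI : Y.Inv σ) (hf : Y.faulty.card ≤ Y.f) (hn : 3 * Y.f < n) {a k : ℕ}
    (hL : ∀ v, a ≤ v → v < a + k → ∀ T j, Y.LargeQuorums σ T v j) : Y.Safe a k σ := by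
  have hlarge : ∀ i v x, (i, v, x) ∈ σ.decided → a ≤ v → v < a + k →
      n + Y.f < 2 * ((σ.voters .commit v x).card + Y.faulty.card) := by
    intro i v x h h1 h2
    obtain ⟨-, C, h3, h4⟩ := hI.decided i v x h
    exact hL v h1 h2 _ i x C h3 h4
  have hchange : ∀ i v x w y, (i, v, x) ∈ σ.decided → a ≤ v → v < w → w < a + k →
      Y.Proposable σ w y → y = x := by
    intro i v x w y h h1 h2 h3
    obtain ⟨m, hm, -, -, hs⟩ := (hI.decided i v x h).1
    exact hI.proposable_eq hf hn (hm ▸ hs.1) (hlarge i v x h h1 (by omega))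
      (fun u hu hu' => hL u (h1.trans hu) hu' _) w h2 h3 y
  refine ⟨?_, ?_, hchange⟩
  · intro i v x h
    obtain ⟨m, -, rfl, -, hs⟩ := (hI.decided i v x h).1
    exact hs.2.2.2.1
  · intro i v x j w y h h' h1 h2 h3 h4
    rcases lt_trichotomy v w with hlt | rfl | hlt
    · exact (hchange i v x w y h h1 hlt h4 (hI.decided j w y h').1).symm
    · exact hI.eq_of_large hf (hlarge i v x h h1 h2) (hlarge j v y h' h3 h4)
    · exact hchange j w y v x h' h3 hlt h2 (hI.decided i v x h).1

/-! ### Expectations -/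

/-- The expectation of `F` under `p`. -/
def expect {α : Type*} (p : PMF α) (F : α → ℝ≥0∞) : ℝ≥0∞ := ∑' a, p a * F a

section Expect

variable {α β : Type*} (p : PMF α)

theorem expect_pure (a : α) (F : α → ℝ≥0∞) : expect (PMF.pure a) F = F a := by
  unfold expect
  rw [tsum_eq_single a]
  · simp
  · intro b hb
    simp [hb]

theorem expect_bind (k : α → PMF β) (F : β → ℝ≥0∞) :
    expect (p.bind k) F = expect p fun a => expect (k a) F := by
  unfold expect
  simp_rw [PMF.bind_apply, ← ENNReal.tsum_mul_right, ← ENNReal.tsum_mul_left]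
  rw [ENNReal.tsum_comm]
  simp_rw [mul_assoc]

theorem expect_map (k : α → β) (F : β → ℝ≥0∞) : expect (p.map k) F = expect p (F ∘ k) := by
  rw [← PMF.bind_pure_comp, expect_bind]
  simp_rw [Function.comp_apply, expect_pure]
  rfl

variable {p}

theorem expect_mono {F G : α → ℝ≥0∞} (h : ∀ a ∈ p.support, F a ≤ G a) :
    expect p F ≤ expect p G := by
  refine ENNReal.tsum_le_tsum fun a => ?_
  by_cases ha : a ∈ p.support
  · gcongr
    exact h a ha
  · simp [(p.apply_eq_zero_iff a).2 ha]

theorem expect_const (c : ℝ≥0∞) : expect p (fun _ => c) = c := by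
  simp [expect, ENNReal.tsum_mul_right, p.tsum_coe]

theorem expect_le {F : α → ℝ≥0∞} {c : ℝ≥0∞} (h : ∀ a ∈ p.support, F a ≤ c) :
    expect p F ≤ c :=
  (expect_mono h).trans (expect_const c).le

/-- A fresh sample enters the potential in this affine form: it multiplies either all of it or the
term of a single value. -/
theorem expect_affine_le {F : α → ℝ≥0∞} (hF : expect p F ≤ 1) (c d e : ℝ≥0∞) :
    expect p (fun a => c * (d + F a * e)) ≤ c * (d + e) := by
  have : expect p (fun a => c * (d + F a * e)) = c * (d + expect p F * e) := by
    unfold expect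
    simp_rw [mul_add, mul_left_comm _ c, ENNReal.tsum_add, ENNReal.tsum_mul_left,
      ENNReal.tsum_mul_right, p.tsum_coe, one_mul, ← mul_assoc (p _), ENNReal.tsum_mul_right]
  rw [this]
  gcongr
  exact mul_le_of_le_one_left' hF

/-- Markov's inequality, with the lower bound required only on the support, because the invariants
hold only for reachable histories. -/
theorem mul_toOuterMeasure_le_expect {F : α → ℝ≥0∞} {c : ℝ≥0∞} {s : Set α}
    (h : ∀ a ∈ s, a ∈ p.support → c ≤ F a) : c * p.toOuterMeasure s ≤ expect p F := by
  rw [PMF.toOuterMeasure_apply, ← ENNReal.tsum_mul_left]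
  refine ENNReal.tsum_le_tsum fun a => ?_
  by_cases ha : a ∈ s
  · rw [Set.indicator_of_mem ha, mul_comm]
    by_cases ha' : a ∈ p.support
    · gcongr
      exact h a ha ha'
    · simp [(p.apply_eq_zero_iff a).2 ha']
  · simp [Set.indicator_of_notMem ha]

end Expect

theorem expect_vrfProve_none {i : Fin n} {v : ℕ} {T : Phase} (h : σ.vrf i v T = none)
    (F : Finset (Fin n) × State n Val → ℝ≥0∞) :
    expect (Y.vrfProve σ i v T) F =
      expect (uniformSample n Y.s) fun S => F (S, σ.record i v T S) := by
  unfold System.vrfProve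
  rw [h]
  exact expect_map _ _ _

/-! ### The exponential weight of a sample -/

/-- The weight that a sample, if drawn, contributes to the potential of replica `j`. -/
def weight (c d : ℝ) (j : Fin n) : Option (Finset (Fin n)) → ℝ≥0∞
  | none => 1
  | some S => ENNReal.ofReal (Real.exp ((if j ∈ S then c else 0) - d))

/-- The probability `r / n` that a random `r`-set contains `j`, without division. The sets avoiding
`j` are the `r`-subsets of its complement; Pascal's rule gives the rest. -/
theorem mul_card_filter_mem_powersetCard (r : ℕ) (j : Fin n) :
    n * ((Finset.powersetCard r (Finset.univ : Finset (Fin n))).filter (j ∈ ·)).card =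
      r * n.choose r := by
  obtain ⟨n, rfl⟩ : ∃ n', n = n' + 1 := ⟨n - 1, by have := j.pos; omega⟩
  have h1 := Finset.card_filter_add_card_filter_not
    (s := Finset.powersetCard r (Finset.univ : Finset (Fin (n + 1)))) (j ∈ ·)
  have h2 : (Finset.powersetCard r (Finset.univ : Finset (Fin (n + 1)))).filter (j ∉ ·) =
      Finset.powersetCard r (Finset.univ.erase j) := by
    ext S
    simp only [Finset.mem_filter, Finset.mem_powersetCard, Finset.subset_univ, true_and]
    rw [Finset.subset_erase]
    simp [and_comm]
  rw [h2] at h1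
  simp only [Finset.card_powersetCard, Finset.card_erase_of_mem (Finset.mem_univ j),
    Finset.card_univ, Fintype.card_fin, Nat.add_sub_cancel] at h1
  cases r with
  | zero => simp
  | succ r =>
    rw [Nat.choose_succ_succ, Nat.add_right_cancel_iff] at h1
    rw [h1, Nat.add_one_mul_choose_eq, mul_comm]

/-- With hit probability `p ≤ s / n`, the exponential moment is `1 + p * (exp c - 1) ≤ 1 + d ≤ exp
d`. This dictates the choice of `d`. -/
theorem expect_weight_le_one (s : ℕ) {c : ℝ} (hc : 0 ≤ c) (j : Fin n) :
    expect (uniformSample n s)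
      (fun S => weight c ((s : ℝ) / n * (Real.exp c - 1)) j (some S)) ≤ 1 := by
  set d := (s : ℝ) / n * (Real.exp c - 1) with hd
  set r := min s n
  set P := Finset.powersetCard r (Finset.univ : Finset (Fin n)) with hP
  have hn : (0 : ℝ) < n := by exact_mod_cast j.pos
  have hcard : P.card = n.choose r := by simp [hP]
  have hN : (0 : ℝ) < P.card := by
    rw [hcard]
    exact_mod_cast Nat.choose_pos (min_le_right s n)
  have hin := mul_card_filter_mem_powersetCard r j
  rw [← hcard] at hin
  have hsplit := Finset.card_filter_add_card_filter_not (s := P) (j ∈ ·)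
  have hval : ∀ S ∈ P, uniformSample n s S * weight c d j (some S) =
      ENNReal.ofReal ((P.card : ℝ)⁻¹ * Real.exp ((if j ∈ S then c else 0) - d)) := by
    intro S hS
    rw [uniformSample, PMF.uniformOfFinset_apply_of_mem _ hS, ENNReal.ofReal_mul (by positivity),
      ENNReal.ofReal_inv_of_pos hN, ENNReal.ofReal_natCast]
    rfl
  have hexp : 1 ≤ Real.exp c := Real.one_le_exp hc
  unfold expect
  rw [tsum_eq_sum (s := P), Finset.sum_congr rfl hval,
    ← ENNReal.ofReal_sum_of_nonneg (fun _ _ => by positivity), ENNReal.ofReal_le_one,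
    ← Finset.mul_sum, inv_mul_le_iff₀ hN, mul_one]
  · have hsum : ∑ S ∈ P, Real.exp ((if j ∈ S then c else 0) - d) =
        ((P.filter (j ∈ ·)).card * Real.exp c + (P.filter (j ∉ ·)).card) * Real.exp (-d) := by
      rw [← Finset.sum_filter_add_sum_filter_not P (j ∈ ·), add_mul]
      congr 1
      · rw [Finset.sum_congr rfl (g := fun _ => Real.exp c * Real.exp (-d))]
        · rw [Finset.sum_const, nsmul_eq_mul, mul_assoc]
        · intro S hS
          rw [if_pos (Finset.mem_filter.1 hS).2, ← Real.exp_add, sub_eq_add_neg]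
      · rw [Finset.sum_congr rfl (g := fun _ => Real.exp (-d))]
        · rw [Finset.sum_const, nsmul_eq_mul]
        · intro S hS
          rw [if_neg (Finset.mem_filter.1 hS).2, zero_sub]
    rw [hsum, Real.exp_neg, ← div_eq_mul_inv, div_le_iff₀ (Real.exp_pos d)]
    have hin' : (n : ℝ) * (P.filter (j ∈ ·)).card = r * P.card := by exact_mod_cast hin
    have hout : ((P.filter (j ∉ ·)).card : ℝ) = P.card - (P.filter (j ∈ ·)).card := by
      rw [← hsplit]; push_cast; ring
    have hin'' : ((P.filter (j ∈ ·)).card : ℝ) ≤ (s : ℝ) / n * P.card := by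
      rw [div_mul_eq_mul_div, le_div_iff₀ hn, mul_comm, hin']
      gcongr
      exact min_le_left s n
    have hle : 1 + d ≤ Real.exp d := by linarith [Real.add_one_le_exp d]
    calc ((P.filter (j ∈ ·)).card * Real.exp c + (P.filter (j ∉ ·)).card : ℝ)
        = P.card + (P.filter (j ∈ ·)).card * (Real.exp c - 1) := by rw [hout]; ring
      _ ≤ P.card + (s : ℝ) / n * P.card * (Real.exp c - 1) := by
          gcongr
      _ = P.card * (1 + d) := by rw [hd]; ring
      _ ≤ P.card * Real.exp d := by gcongr
  · intro S hS
    rw [uniformSample, PMF.uniformOfFinset_apply_of_notMem _ hS, zero_mul]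

/-! ### The potential -/

section Potential

variable (Y) (σ) (c d : ℝ) (T : Phase) (v : ℕ) (j : Fin n)

/-- The weight of all samples of type `T` for view `v` of the replicas in `D`. -/
def State.weightOf (D : Finset (Fin n)) : ℝ≥0∞ := ∏ i ∈ D, weight c d j (σ.vrf i v T)

open Classical in
/-- The correct replicas that have not voted yet in phase `T` of view `v`. -/
def System.undrawn : Finset (Fin n) := {i | i ∉ Y.faulty ∧ σ.vrf i v T = none}

open Classical in
/-- A supermartingale that is large if replica `j` receives, in phase `T` of view `v`, a quorum
for a value that few correct replicas have voted for. -/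
def System.potential : ℝ≥0∞ :=
  σ.weightOf c d T v j Y.faulty * (1 + (Y.undrawn σ T v).card +
    ∑' x, if (σ.voters T v x).Nonempty then σ.weightOf c d T v j (σ.voters T v x) else 0)

end Potential

/-! ### The potential is a supermartingale, and it is large when a quorum is not -/

section Steps

variable {c d : ℝ} {T : Phase} {v : ℕ} {j : Fin n}

theorem System.potential_congr (hvrf : ∀ i, σ'.vrf i v T = σ.vrf i v T)
    (hvote : ∀ x, σ'.voters T v x = σ.voters T v x) :
    Y.potential σ' c d T v j = Y.potential σ c d T v j := by
  simp only [System.potential, State.weightOf, System.undrawn, hvrf, hvote]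

theorem State.voters_congr (h : ∀ w, Msg.vote w ∈ σ'.sent ↔ Msg.vote w ∈ σ.sent) (x : Val) :
    σ'.voters T v x = σ.voters T v x := by
  ext i
  simp only [State.mem_voters, h]

/-- A faulty replica can support every value with one and the same sample, so its weight is a common
factor of the whole potential. -/
theorem System.expect_potential_record_le (hI : Y.Inv σ) {b : Fin n} (hb : b ∈ Y.faulty)
    (h : σ.vrf b v T = none)
    (hE : expect (uniformSample n Y.s) (fun S => weight c d j (some S)) ≤ 1) :
    expect (uniformSample n Y.s) (fun S => Y.potential (σ.record b v T S) c d T v j) ≤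
      Y.potential σ c d T v j := by
  classical
  have hne : ∀ S i, i ≠ b → (σ.record b v T S).vrf i v T = σ.vrf i v T := fun S i hi => by
    simp [State.record, hi]
  have hG : ∀ S, (σ.record b v T S).weightOf c d T v j Y.faulty =
      weight c d j (some S) * σ.weightOf c d T v j Y.faulty := fun S => by
    unfold State.weightOf
    rw [← Finset.mul_prod_erase _ _ hb, ← Finset.mul_prod_erase _ _ hb, State.record_self, h]
    rw [Finset.prod_congr rfl fun i hi => by rw [hne S i (Finset.ne_of_mem_erase hi)]]
    simp [weight]
  have hR : ∀ S, Y.undrawn (σ.record b v T S) T v = Y.undrawn σ T v := fun S => by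
    ext i
    simp only [System.undrawn, Finset.mem_filter, Finset.mem_univ, true_and]
    refine and_congr_right fun hi => ?_
    rw [hne S i (by rintro rfl; exact hi hb)]
  have hW : ∀ S x, (σ.record b v T S).weightOf c d T v j (σ.voters T v x) =
      σ.weightOf c d T v j (σ.voters T v x) := fun S x => by
    refine Finset.prod_congr rfl fun i hi => ?_
    rw [hne S i (by rintro rfl; exact hI.voters_correct hi hb)]
  have key : ∀ S, Y.potential (σ.record b v T S) c d T v j =
      1 * (0 + weight c d j (some S) * Y.potential σ c d T v j) := fun S => by
    have hV : ∀ x, (σ.record b v T S).voters T v x = σ.voters T v x := fun x => rfl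
    simp only [System.potential, hG, hR, hV, hW]
    ring
  simp_rw [key]
  refine (expect_affine_le hE 1 0 _).trans ?_
  simp

/-- The voter `i` leaves the reserve, which cancels the summand `1`, and its weight multiplies the
term of `x` alone. The right-hand side isolates this only dependence on `S`. -/
theorem System.potential_vote (hI : Y.Inv σ) {i : Fin n} {x : Val} {S : Finset (Fin n)}
    (hi : i ∉ Y.faulty) (h : σ.vrf i v T = none)
    (hvrf : ∀ k, σ'.vrf k v T = (σ.record i v T S).vrf k v T)
    (hvote : ∀ y, y ≠ x → σ'.voters T v y = σ.voters T v y)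
    (hvote' : ∀ k, k ∈ σ'.voters T v x ↔ k = i ∨ k ∈ σ.voters T v x) :
    Y.potential σ' c d T v j = σ.weightOf c d T v j Y.faulty *
      (((Y.undrawn σ T v).card + ∑' y, open Classical in if y = x then 0 else
        if (σ.voters T v y).Nonempty then σ.weightOf c d T v j (σ.voters T v y) else 0) +
        weight c d j (some S) * σ.weightOf c d T v j (σ.voters T v x)) := by
  classical
  have hnot : ∀ y, i ∉ σ.voters T v y := fun y hy => by
    obtain ⟨p, R, rfl, -, hp⟩ := State.mem_voters.1 hy
    have := hI.vrf_eq _ hp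
    dsimp only at this
    rw [h] at this
    cases this
  have hne : ∀ k, k ≠ i → σ'.vrf k v T = σ.vrf k v T := fun k hk => by
    rw [hvrf]
    simp [State.record, hk]
  have hself : σ'.vrf i v T = some S := by rw [hvrf, State.record_self]
  have hcongr : ∀ D : Finset (Fin n), i ∉ D → σ'.weightOf c d T v j D = σ.weightOf c d T v j D :=
    fun D hD => Finset.prod_congr rfl fun k hk => by rw [hne k (by rintro rfl; exact hD hk)]
  have hx : σ'.voters T v x = insert i (σ.voters T v x) := by
    ext k
    rw [hvote', Finset.mem_insert]
  have hWx : σ'.weightOf c d T v j (σ'.voters T v x) =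
      weight c d j (some S) * σ.weightOf c d T v j (σ.voters T v x) := by
    rw [hx, State.weightOf, Finset.prod_insert (hnot x), hself]
    congr 1
    exact hcongr _ (hnot x)
  have hR : Y.undrawn σ T v = insert i (Y.undrawn σ' T v) := by
    ext k
    simp only [System.undrawn, Finset.mem_filter, Finset.mem_univ, true_and, Finset.mem_insert]
    by_cases hk : k = i
    · subst hk
      simp [hi, h]
    · simp [hk, hne k hk]
  have hR' : (Y.undrawn σ T v).card = (Y.undrawn σ' T v).card + 1 := by
    rw [hR, Finset.card_insert_of_notMem]
    simp [System.undrawn, hself]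
  unfold System.potential
  rw [hcongr _ hi, ENNReal.tsum_eq_add_tsum_ite x, if_pos (by rw [hx]; exact Finset.insert_nonempty _ _),
    hWx, hR']
  have hs : ∀ y, (if y = x then (0 : ℝ≥0∞) else if (σ'.voters T v y).Nonempty then
        σ'.weightOf c d T v j (σ'.voters T v y) else 0) =
      if y = x then 0 else if (σ.voters T v y).Nonempty then
        σ.weightOf c d T v j (σ.voters T v y) else 0 := fun y => by
    by_cases hy : y = x
    · simp [hy]
    · rw [if_neg hy, if_neg hy, hvote y hy, hcongr _ (hnot y)]
  simp_rw [hs]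
  push_cast
  ring

/-- The left side is `potential_vote` with the new weight replaced by its bound `1`. If `x` already
had voters, its term was in the sum; if not, its empty product `1` is paid for by the reserve unit
that the voter gave up. -/
theorem System.vote_bound_le_potential (x : Val) :
    σ.weightOf c d T v j Y.faulty *
      (((Y.undrawn σ T v).card + ∑' y, open Classical in if y = x then 0 else
        if (σ.voters T v y).Nonempty then σ.weightOf c d T v j (σ.voters T v y) else 0) +
        σ.weightOf c d T v j (σ.voters T v x)) ≤ Y.potential σ c d T v j := by
  classical
  unfold System.potential
  refine mul_le_mul_right ?_ _
  rw [ENNReal.tsum_eq_add_tsum_ite (f := fun y => if (σ.voters T v y).Nonempty then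
    σ.weightOf c d T v j (σ.voters T v y) else 0) x]
  split_ifs with hx
  · rw [add_assoc, add_comm (∑' y, _), add_assoc]
    exact le_add_self
  · rw [Finset.not_nonempty_iff_eq_empty.1 hx]
    simp only [State.weightOf, Finset.prod_empty]
    rw [zero_add, add_assoc, add_comm _ (1 : ℝ≥0∞), ← add_assoc, add_comm (1 : ℝ≥0∞), add_assoc]

theorem System.expect_potential_vote_le (hI : Y.Inv σ)
    (hE : expect (uniformSample n Y.s) (fun S => weight c d j (some S)) ≤ 1)
    {i : Fin n} (hi : i ∉ Y.faulty) {U : Phase} {p : Proposal n Val}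
    {F : Finset (Fin n) × State n Val → State n Val}
    (hvrf : ∀ r, (F r).vrf = r.2.vrf)
    (hsent : ∀ r, (F r).sent = insert (Msg.vote ⟨U, p, r.1, i⟩) r.2.sent)
    (hown : ∀ S p', p'.view = p.view → Msg.vote ⟨U, p', S, i⟩ ∈ σ.sent → p' = p) :
    expect ((Y.vrfProve σ i p.view U).map F) (fun τ => Y.potential τ c d T v j) ≤
      Y.potential σ c d T v j := by
  classical
  have hmem : ∀ r ∈ (Y.vrfProve σ i p.view U).support, ∀ w,
      Msg.vote w ∈ (F r).sent ↔ w = ⟨U, p, r.1, i⟩ ∨ Msg.vote w ∈ σ.sent := by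
    intro r hr w
    rw [hsent, (System.mem_support_vrfProve hr).2]
    simp [State.record]
  rw [expect_map]
  -- A vote in another phase or view leaves this potential unchanged.
  by_cases hTv : T = U ∧ v = p.view
  swap
  · refine expect_le fun r hr => (System.potential_congr (fun k => ?_) fun x => ?_).le
    · rw [hvrf, (System.mem_support_vrfProve hr).2]
      unfold State.record
      dsimp only
      rw [if_neg]
      rintro ⟨-, h1, h2⟩
      exact hTv ⟨h2, h1⟩
    · ext k
      simp only [State.mem_voters, hmem r hr]
      constructor
      · rintro ⟨p', S, h1, h2, h3 | h3⟩
        · injection h3 with h4 h5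
          subst h5
          exact absurd ⟨h4, h1.symm⟩ hTv
        · exact ⟨p', S, h1, h2, h3⟩
      · rintro ⟨p', S, h1, h2, h3⟩
        exact ⟨p', S, h1, h2, Or.inr h3⟩
  obtain ⟨rfl, rfl⟩ := hTv
  cases hS : σ.vrf i p.view T with
  | some S =>
    -- A sample already drawn by a correct replica belongs to a vote already sent, so this vote is a
    -- repetition.
    obtain ⟨p', hp, hv⟩ := hI.drawn _ _ _ _ hi hS
    have hpp := hown S p' hp hv
    subst hpp
    refine expect_le fun r hr => (System.potential_congr (fun k => ?_) fun x => ?_).le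
    · obtain ⟨h1, h2⟩ := System.mem_support_vrfProve hr
      rw [hvrf, h2, State.record_eq_self (h1.resolve_left (by rw [hS]; simp))]
    · refine State.voters_congr (fun w => ?_) x
      rw [hmem r hr, or_iff_right_of_imp]
      rintro rfl
      obtain ⟨h1, -⟩ := System.mem_support_vrfProve hr
      rw [hS] at h1
      have h2 := Option.some_injective _ (h1.resolve_left (by simp))
      rwa [← h2]
  | none =>
    rw [expect_vrfProve_none hS]
    refine le_trans (le_of_eq ?_) ((expect_affine_le hE _ _ _).trans
      (System.vote_bound_le_potential p.val))
    congr 1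
    funext S
    refine System.potential_vote hI hi hS (fun k => by rw [hvrf]) (fun y hy => ?_) (fun k => ?_)
    · ext k
      simp only [State.mem_voters, hsent, Set.mem_insert_iff]
      constructor
      · rintro ⟨p', R, h1, h2, h3 | h3⟩
        · injection h3 with h3
          injection h3 with h4 h5
          subst h5
          exact absurd h2.symm hy
        · exact ⟨p', R, h1, h2, h3⟩
      · rintro ⟨p', R, h1, h2, h3⟩
        exact ⟨p', R, h1, h2, Or.inr h3⟩
    · simp only [State.mem_voters, hsent, Set.mem_insert_iff]
      constructor
      · rintro ⟨p', R, h1, h2, h3 | h3⟩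
        · injection h3 with h3
          injection h3 with h4 h5 h6 h7
          exact Or.inl h7
        · exact Or.inr ⟨p', R, h1, h2, h3⟩
      · rintro (rfl | ⟨p', R, h1, h2, h3⟩)
        · exact ⟨p, S, rfl, rfl, Or.inl rfl⟩
        · exact ⟨p', R, h1, h2, Or.inr h3⟩

theorem System.expect_potential_evalVRF_le (hI : Y.Inv σ)
    (hE : expect (uniformSample n Y.s) (fun S => weight c d j (some S)) ≤ 1)
    {b : Fin n} (hb : b ∈ Y.faulty) {w : ℕ} {U : Phase} :
    expect ((Y.vrfProve σ b w U).map Prod.snd) (fun τ => Y.potential τ c d T v j) ≤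
      Y.potential σ c d T v j := by
  rw [expect_map]
  by_cases h : (T = U ∧ v = w) ∧ σ.vrf b w U = none
  · obtain ⟨⟨rfl, rfl⟩, h⟩ := h
    rw [expect_vrfProve_none h]
    exact System.expect_potential_record_le hI hb h hE
  · refine expect_le fun r hr => ?_
    obtain ⟨h1, h2⟩ := System.mem_support_vrfProve hr
    rw [Function.comp_apply, h2]
    refine le_of_eq (System.potential_congr (fun k => ?_) fun x => ?_)
    swap
    · exact State.voters_congr (fun w => by simp [State.record]) x
    by_cases hTv : T = U ∧ v = w
    · rw [State.record_eq_self (h1.resolve_left fun h1 => h ⟨hTv, h1⟩)]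
    · unfold State.record
      dsimp only
      rw [if_neg]
      rintro ⟨-, h3, h4⟩
      exact hTv ⟨h4, h3⟩

theorem System.expect_potential_step_le (hI : Y.Inv σ)
    (hE : expect (uniformSample n Y.s) (fun S => weight c d j (some S)) ≤ 1)
    (a : Action n Val) :
    expect (Y.step σ a) (fun τ => Y.potential τ c d T v j) ≤ Y.potential σ c d T v j := by
  have hpure : ∀ τ : State n Val, τ.vrf = σ.vrf →
      (∀ w, Msg.vote w ∈ τ.sent ↔ Msg.vote w ∈ σ.sent) →
      expect (PMF.pure τ) (fun τ => Y.potential τ c d T v j) ≤ Y.potential σ c d T v j := by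
    intro τ h1 h2
    rw [expect_pure]
    exact (System.potential_congr (fun _ => by rw [h1]) (State.voters_congr h2)).le
  cases a with
  | newView i v =>
    simp only [System.step]
    split_ifs <;> refine hpure _ rfl fun w => ?_ <;> simp [State.send, State.setLoc]
  | lead i M y =>
    simp only [System.step]
    split_ifs <;> refine hpure _ rfl fun w => ?_ <;> simp [State.send]
  | receivePropose i m =>
    simp only [System.step]
    split_ifs with h
    · obtain ⟨h1, h2, h3, h4, h5, h6⟩ := h
      rw [h4]
      refine System.expect_potential_vote_le hI hE h1 (fun _ => rfl) (fun _ => rfl) ?_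
      -- Vacuous: an earlier vote in this view would have left a recorded proposal.
      intro S p' hp hS
      obtain ⟨m', hm', -⟩ := hI.current _ hS (hp.trans h4.symm)
      dsimp only at hm'
      rw [h5] at hm'
      cases hm'
    · exact hpure _ rfl fun w => Iff.rfl
  | receivePrepares i C =>
    simp only [System.step]
    split
    · exact hpure _ rfl fun w => Iff.rfl
    · rename_i m hm
      split_ifs with h
      · obtain ⟨h1, h2⟩ := hI.proposal i m hm
        obtain ⟨S, h2⟩ := h2
        rw [← h1]
        refine System.expect_potential_vote_le hI hE h.1 (fun _ => rfl) (fun _ => rfl) ?_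
        exact fun S' p' hp hS' => hI.unique _ _ hS' h2 rfl hp
      · exact hpure _ rfl fun w => Iff.rfl
  | receiveCommits i C =>
    simp only [System.step]
    split
    · exact hpure _ rfl fun w => Iff.rfl
    · split_ifs <;> exact hpure _ rfl fun w => Iff.rfl
  | receiveConflict i p =>
    simp only [System.step]
    split
    · exact hpure _ rfl fun w => Iff.rfl
    · split_ifs <;> exact hpure _ rfl fun w => Iff.rfl
  | evalVRF b w U =>
    simp only [System.step]
    split_ifs with h
    · exact System.expect_potential_evalVRF_le hI hE h
    · exact hpure _ rfl fun w => Iff.rfl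

theorem System.potential_init_le :
    Y.potential (State.init n Val) c d T v j ≤ (n : ℝ≥0∞) + 1 := by
  have h1 : ∀ D, (State.init n Val).weightOf c d T v j D = 1 := fun D => by
    simp [State.weightOf, State.init, weight]
  have h2 : ∀ x, (State.init n Val).voters T v x = ∅ := fun x => by
    ext i
    simp [State.mem_voters, State.init]
  unfold System.potential
  simp only [h1, h2, Finset.not_nonempty_empty, if_false, tsum_zero, add_zero, one_mul]
  rw [add_comm]
  gcongr
  exact (Finset.card_le_univ _).trans (Fintype.card_fin n).le

/-- The one-step bound holds for each action separately, so it survives averaging over the random,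
history-dependent choice of the adversary. -/
theorem System.expect_potential_run_le (A : Adversary n Val) (t : ℕ)
    (hE : expect (uniformSample n Y.s) (fun S => weight c d j (some S)) ≤ 1) :
    expect (Y.run A t) (fun h => Y.potential h.current c d T v j) ≤ (n : ℝ≥0∞) + 1 := by
  induction t with
  | zero =>
    rw [System.run, expect_pure]
    exact System.potential_init_le
  | succ t ih =>
    rw [System.run, expect_bind]
    refine (expect_mono fun h hh => ?_).trans ih
    rw [expect_bind]
    refine expect_le fun a _ => ?_
    rw [expect_map]
    exact System.expect_potential_step_le (System.Inv.of_mem_support_run hh) hE a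

/-- Let `D` consist of the faulty replicas and the voters of the offending value. Authenticity puts
all `q` senders of the quorum in `D`, each with a sample containing `j`, while `D` has at most `(n +
f) / 2` members, each costing at most a factor `exp (-d)`. -/
theorem System.Inv.le_potential (hI : Y.Inv σ) (hc : 0 ≤ c) (hd : 0 ≤ d)
    (h : ¬ Y.LargeQuorums σ T v j) :
    ENNReal.ofReal (Real.exp (c * Y.q - d * (((n : ℝ) + Y.f) / 2))) ≤
      Y.potential σ c d T v j := by
  classical
  unfold System.LargeQuorums at h
  push Not at h
  obtain ⟨x, C, hauth, ⟨hcard, hinj, hC⟩, hle⟩ := h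
  have hdisj : Disjoint Y.faulty (σ.voters T v x) :=
    Finset.disjoint_right.2 fun i hi => hI.voters_correct hi
  set D := Y.faulty ∪ σ.voters T v x with hD
  have hDcard : (D.card : ℝ) ≤ ((n : ℝ) + Y.f) / 2 := by
    have : 2 * D.card ≤ n + Y.f := by
      rw [hD, Finset.card_union_of_disjoint hdisj]; omega
    have : (2 : ℝ) * D.card ≤ n + Y.f := by exact_mod_cast this
    linarith
  let H := D.filter fun i => ∃ S, σ.vrf i v T = some S ∧ j ∈ S
  have hH : Y.q ≤ H.card := by
    rw [← hcard, ← Finset.card_image_of_injOn hinj]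
    refine Finset.card_le_card fun i hi => ?_
    obtain ⟨w, hw, rfl⟩ := Finset.mem_image.1 hi
    obtain ⟨h1, h2, h3, h4, h5⟩ := hC w hw
    refine Finset.mem_filter.2 ⟨Finset.mem_union.2 ?_, w.sample, h5, h4⟩
    refine (hauth w hw).1.imp_right fun h6 => State.mem_voters.2 ⟨w.prop, w.sample, h2, h3, ?_⟩
    rw [← h1]
    exact h6
  have hterm : ∀ i ∈ D, ENNReal.ofReal (Real.exp
      ((if ∃ S, σ.vrf i v T = some S ∧ j ∈ S then c else 0) - d)) ≤
        weight c d j (σ.vrf i v T) := by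
    intro i _
    cases hS : σ.vrf i v T with
    -- An undrawn sample has weight `1`, which is at least `exp (-d)`.
    | none => simpa [weight] using hd
    | some S => simp [weight]
  have hprod : σ.weightOf c d T v j D ≤ Y.potential σ c d T v j := by
    unfold System.potential
    rw [hD, State.weightOf, Finset.prod_union hdisj]
    change σ.weightOf c d T v j Y.faulty * σ.weightOf c d T v j (σ.voters T v x) ≤ _
    gcongr
    rw [ENNReal.tsum_eq_add_tsum_ite x]
    split_ifs with hx
    · exact le_self_add.trans le_add_self
    -- A quorum made of faulty replicas alone is covered by the summand `1` of the potential.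
    · rw [Finset.not_nonempty_iff_eq_empty.1 hx, add_assoc]
      exact le_self_add
  refine le_trans ?_ ((Finset.prod_le_prod' hterm).trans hprod)
  rw [← ENNReal.ofReal_prod_of_nonneg (fun _ _ => (Real.exp_pos _).le), ← Real.exp_sum]
  refine ENNReal.ofReal_le_ofReal (Real.exp_le_exp.2 ?_)
  rw [Finset.sum_sub_distrib, ← Finset.sum_filter, Finset.sum_const, Finset.sum_const,
    nsmul_eq_mul, nsmul_eq_mul, mul_comm c, mul_comm d]
  have : (Y.q : ℝ) ≤ H.card := by exact_mod_cast hH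
  gcongr

theorem System.prob_not_largeQuorums_le (A : Adversary n Val) (t : ℕ) (hc : 0 ≤ c)
    (T : Phase) (v : ℕ) (j : Fin n) :
    (Y.run A t).toOuterMeasure {h | ¬ Y.LargeQuorums h.current T v j} ≤
      ENNReal.ofReal (((n : ℝ) + 1) * Real.exp
        (-(c * Y.q - (Y.s : ℝ) / n * (Real.exp c - 1) * (((n : ℝ) + Y.f) / 2)))) := by
  have hd : 0 ≤ (Y.s : ℝ) / n * (Real.exp c - 1) :=
    mul_nonneg (by positivity) (by linarith [Real.one_le_exp hc])
  have h1 := System.expect_potential_run_le (T := T) (v := v) A t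
    (expect_weight_le_one Y.s hc j)
  have h2 := (mul_toOuterMeasure_le_expect (p := Y.run A t)
    (s := {h | ¬ Y.LargeQuorums h.current T v j}) fun h hh hs =>
      (System.Inv.of_mem_support_run hs).le_potential hc hd hh).trans h1
  rw [Real.exp_neg, ENNReal.ofReal_mul (by positivity),
    ENNReal.ofReal_inv_of_pos (Real.exp_pos _), ← div_eq_mul_inv,
    ENNReal.le_div_iff_mul_le (by simp [Real.exp_pos]) (by simp), mul_comm]
  refine h2.trans (le_of_eq ?_)
  rw [ENNReal.ofReal_add (by positivity) zero_le_one]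
  simp

end Steps

/-! ### The bound -/

theorem System.prob_not_safe_le (A : Adversary n Val) (a k t : ℕ) (hf : Y.faulty.card ≤ Y.f)
    (hn : 3 * Y.f < n) {B : ℝ≥0∞}
    (hB : ∀ T v j, (Y.run A t).toOuterMeasure {h | ¬ Y.LargeQuorums h.current T v j} ≤ B) :
    (Y.run A t).toOuterMeasure {h | ¬ Y.Safe a k h.current} ≤ k * (n * (2 * B)) := by
  have hsub : (Y.run A t).toOuterMeasure {h | ¬ Y.Safe a k h.current} ≤
      (Y.run A t).toOuterMeasure (⋃ v ∈ Finset.Ico a (a + k), ⋃ j ∈ (Finset.univ : Finset (Fin n)),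
        ({h | ¬ Y.LargeQuorums h.current .prepare v j} ∪
          {h | ¬ Y.LargeQuorums h.current .commit v j})) := by
    -- Only histories in the support need to be compared, and for these the invariants are
    -- available.
    refine PMF.toOuterMeasure_mono _ ?_
    rintro h ⟨hns, hs⟩
    by_contra hcon
    refine hns ((System.Inv.of_mem_support_run hs).safe hf hn fun v h1 h2 T j => ?_)
    simp only [Finset.mem_univ, Set.iUnion_true, Set.mem_iUnion, not_exists, Set.mem_union,
      Set.mem_ofPred_eq, not_or, not_not, Finset.mem_Ico] at hcon
    obtain ⟨h3, h4⟩ := hcon v ⟨h1, h2⟩ j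
    cases T
    · exact h3
    · exact h4
  refine hsub.trans ((MeasureTheory.measure_biUnion_finset_le _ _).trans ?_)
  refine (Finset.sum_le_card_nsmul _ _ (n * (2 * B)) fun v _ => ?_).trans (by simp)
  refine (MeasureTheory.measure_biUnion_finset_le _ _).trans ?_
  refine (Finset.sum_le_card_nsmul _ _ (2 * B) fun j _ => ?_).trans (by simp)
  refine (MeasureTheory.measure_union_le _ _).trans ?_
  rw [two_mul]
  exact add_le_add (hB _ _ _) (hB _ _ _)

theorem one_sub_le_toReal_toOuterMeasure {α : Type*} (p : PMF α) (s : Set α) {x : ℝ}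
    (hx : 0 ≤ x) (h : p.toOuterMeasure sᶜ ≤ ENNReal.ofReal x) :
    1 - x ≤ (p.toOuterMeasure s).toReal := by
  have h1 : (1 : ℝ≥0∞) ≤ p.toOuterMeasure s + p.toOuterMeasure sᶜ := by
    rw [← (p.toOuterMeasure_apply_eq_one_iff Set.univ).2 (Set.subset_univ _),
      ← Set.union_compl_self s]
    exact MeasureTheory.measure_union_le _ _
  have h2 : p.toOuterMeasure s ≤ 1 := by
    rw [← (p.toOuterMeasure_apply_eq_one_iff Set.univ).2 (Set.subset_univ _)]
    exact MeasureTheory.measure_mono (Set.subset_univ _)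
  have h2' : p.toOuterMeasure s ≠ ∞ := ne_top_of_le_ne_top ENNReal.one_ne_top h2
  have h3 := ENNReal.toReal_mono (by finiteness) (h1.trans (add_le_add le_rfl h))
  rw [ENNReal.toReal_add (by finiteness) (by finiteness), ENNReal.toReal_ofReal hx,
    ENNReal.toReal_one] at h3
  linarith

/-! ### The exponent and its asymptotics -/

/-- With `r = (1 + δ)⁻¹`, a set of `(n + f) / 2` replicas hits `j` at most `r * q + 1` times on
average, where the `1` comes from rounding the sample size. Since `exp c - 1 ≤ c + c ^ 2` and `r = 1
- 2 * c`, the main term is at least `c * q - (c + c ^ 2) * (1 - 2 * c) * q = (c ^ 2 + 2 * c ^ 3) *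
q`. -/
theorem chernoff_exponent_le {l o δ : ℝ} {n f : ℕ} (hl : 1 ≤ l) (ho : 1 < o) (hδ : 0 < δ)
    (hf : 3 * f < n) (h : δ ≤ 2 * (n : ℝ) / (o * ((n : ℝ) + f)) - 1) {c : ℝ}
    (hc : c = (1 - (1 + δ)⁻¹) / 2) :
    c ^ 2 * √(n : ℝ) - 2 ≤ c * quorumSize l n -
      (sampleSize o l n : ℝ) / n * (Real.exp c - 1) * (((n : ℝ) + f) / 2) := by
  set r := (1 + δ)⁻¹ with hr
  set q : ℝ := (quorumSize l n : ℝ)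
  set s : ℝ := (sampleSize o l n : ℝ)
  have hr0 : 0 < r := by positivity
  have hr1 : r < 1 := inv_lt_one_of_one_lt₀ (by linarith)
  have hn : (0 : ℝ) < n := by exact_mod_cast (by omega : 0 < n)
  have hfn : (f : ℝ) ≤ n := by exact_mod_cast (by omega : f ≤ n)
  have hf0 : (0 : ℝ) ≤ f := by positivity
  have hq : √(n : ℝ) ≤ q := by
    have h1 : l * √(n : ℝ) ≤ q := Nat.le_ceil _
    nlinarith [Real.sqrt_nonneg (n : ℝ)]
  have hq0 : 0 ≤ q := (Real.sqrt_nonneg _).trans hq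
  have hs : s ≤ o * q + 1 := (Nat.ceil_lt_add_one (by positivity)).le
  have hload : o * ((n : ℝ) + f) / (2 * n) ≤ r := by
    have h1 : 1 + δ ≤ 2 * (n : ℝ) / (o * ((n : ℝ) + f)) := by linarith
    rw [hr, ← inv_div]
    exact inv_anti₀ (by linarith) h1
  have hmean : s / n * (((n : ℝ) + f) / 2) ≤ r * q + 1 := by
    have h1 : ((n : ℝ) + f) / (2 * n) ≤ 1 := by
      rw [div_le_one (by positivity)]; linarith
    calc s / n * (((n : ℝ) + f) / 2) = s * (((n : ℝ) + f) / (2 * n)) := by field_simp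
      _ ≤ (o * q + 1) * (((n : ℝ) + f) / (2 * n)) := by gcongr
      _ = o * ((n : ℝ) + f) / (2 * n) * q + ((n : ℝ) + f) / (2 * n) := by ring
      _ ≤ r * q + 1 := by gcongr
  have hc0 : 0 < c := by rw [hc]; linarith
  have hc1 : c ≤ 1 := by rw [hc]; linarith
  have hexp : Real.exp c - 1 ≤ c + c ^ 2 := by
    have h1 := Real.abs_exp_sub_one_sub_id_le (x := c) (by rw [abs_of_pos hc0]; exact hc1)
    linarith [(abs_le.1 h1).2]
  have h1 : s / n * (Real.exp c - 1) * (((n : ℝ) + f) / 2) ≤ (c + c ^ 2) * (r * q + 1) := by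
    calc s / n * (Real.exp c - 1) * (((n : ℝ) + f) / 2)
        = (Real.exp c - 1) * (s / n * (((n : ℝ) + f) / 2)) := by ring
      _ ≤ (c + c ^ 2) * (r * q + 1) := by gcongr
  have hr2 : r = 1 - 2 * c := by rw [hc]; ring
  have h2 : c ^ 2 * √(n : ℝ) ≤ c ^ 2 * q := by gcongr
  have h3 : c * q - c ^ 2 * q ≥ (c + c ^ 2) * (r * q) := by
    rw [hr2]
    have : 0 ≤ c ^ 3 * q := by positivity
    nlinarith
  -- The rounding costs `c + c ^ 2`, at most `2` because `c ≤ 1`.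
  nlinarith

/-- The polynomial factor lost in the union bound and in the initial potential contributes only a
logarithm, which is `o(√n)`. -/
theorem isTheta_sqrt_sub_log {c : ℝ} (hc : 0 < c) :
    (fun n : ℕ => c * √(n : ℝ) - 2 - Real.log (2 * n * (n + 1))) =Θ[Filter.atTop]
      fun n : ℕ => √(n : ℝ) := by
  have hcast := tendsto_natCast_atTop_atTop (R := ℝ)
  have hlog : (fun n : ℕ => Real.log n) =o[Filter.atTop] fun n : ℕ => √(n : ℝ) := by
    simp_rw [Real.sqrt_eq_rpow]
    exact (isLittleO_log_rpow_atTop (by norm_num)).comp_tendsto hcast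
  have hsqrt : Filter.Tendsto (fun n : ℕ => √(n : ℝ)) Filter.atTop Filter.atTop :=
    Real.tendsto_sqrt_atTop.comp hcast
  have hconst : ∀ b : ℝ, (fun _ : ℕ => b) =o[Filter.atTop] fun n : ℕ => √(n : ℝ) := fun b =>
    Asymptotics.isLittleO_const_left.2 (Or.inr (tendsto_norm_atTop_atTop.comp hsqrt))
  have hrest : (fun n : ℕ => 2 + Real.log (2 * n * (n + 1))) =o[Filter.atTop]
      fun n : ℕ => √(n : ℝ) := by
    refine Asymptotics.IsBigO.trans_isLittleO (g := fun n : ℕ => (2 + Real.log 4) +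
      2 * Real.log n) ?_ ((hconst _).add (hlog.const_mul_left 2))
    refine Asymptotics.IsBigO.of_bound 1 ?_
    filter_upwards [Filter.eventually_ge_atTop 1] with n hn
    have hn' : (1 : ℝ) ≤ n := by exact_mod_cast hn
    have h1 : 0 ≤ Real.log (2 * n * (n + 1)) := Real.log_nonneg (by nlinarith)
    have h2 : Real.log (2 * n * (n + 1)) ≤ Real.log 4 + 2 * Real.log n := by
      rw [← Real.log_rpow (by linarith), ← Real.log_mul (by norm_num) (by positivity)]
      -- For `n ≥ 1`, `2 * n * (n + 1) ≤ 4 * n ^ 2`.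
      refine Real.log_le_log (by positivity) ?_
      norm_num
      nlinarith
    rw [one_mul, Real.norm_of_nonneg (by linarith), Real.norm_of_nonneg (by linarith)]
    linarith
  have hmain : (fun n : ℕ => c * √(n : ℝ)) =Θ[Filter.atTop] fun n : ℕ => √(n : ℝ) :=
    (Asymptotics.isTheta_refl _ _).const_mul_left hc.ne'
  have hsplit : (fun n : ℕ => c * √(n : ℝ) - 2 - Real.log (2 * n * (n + 1))) =
      (fun n : ℕ => c * √(n : ℝ)) + fun n : ℕ => -(2 + Real.log (2 * n * (n + 1))) := by
    funext n
    simp only [Pi.add_apply]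
    ring
  rw [hsplit]
  exact hmain.add_isLittleO hrest.neg_left

end ProBFT

end

theorem mainTheorem1 (l o δ₀ : ℝ) (hl : 1 ≤ l) (ho : 1 < o) (hδ₀ : 0 < δ₀) :
    ∃ g : ℕ → ℝ, (g =Θ[Filter.atTop] fun n : ℕ => √(n : ℝ)) ∧
      ∀ (n : ℕ) (Val : Type*) (Y : ProBFT.System n Val),
        Y.q = ProBFT.quorumSize l n →
        Y.s = ProBFT.sampleSize o l n →
        3 * Y.f < n →
        Y.faulty.card ≤ Y.f →
        δ₀ ≤ 2 * (n : ℝ) / (o * ((n : ℝ) + (Y.f : ℝ))) - 1 →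
        ∀ (A : ProBFT.Adversary n Val) (a k t : ℕ),
          1 - (k : ℝ) * Real.exp (-g n) ≤
            ((Y.run A t).toOuterMeasure {h | Y.Safe a k h.current}).toReal := by
  have hr : (1 + δ₀)⁻¹ < 1 := inv_lt_one_of_one_lt₀ (by linarith)
  obtain ⟨c, hc⟩ : ∃ c, c = (1 - (1 + δ₀)⁻¹) / 2 := ⟨_, rfl⟩
  have hc0 : 0 < c := by rw [hc]; linarith
  -- This fixes `g n = c ^ 2 * √n - 2 - log (2 * n * (n + 1))`. In the logarithm, `2` counts the
  -- phases, `n` the receivers, and `n + 1` bounds the initial potential.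
  refine ⟨_, ProBFT.isTheta_sqrt_sub_log (pow_pos hc0 2), ?_⟩
  intro n Val Y hq hs hf hfaulty hδ A a k t
  have hn : (0 : ℝ) < n := by exact_mod_cast (by omega : 0 < n)
  refine ProBFT.one_sub_le_toReal_toOuterMeasure _ _ (by positivity) ?_
  have hexp := ProBFT.chernoff_exponent_le hl ho hδ₀ hf hδ hc
  rw [← hq, ← hs] at hexp
  refine (ProBFT.System.prob_not_safe_le A a k t hfaulty hf fun T v j =>
    (ProBFT.System.prob_not_largeQuorums_le A t hc0.le T v j).trans
      (ENNReal.ofReal_le_ofReal (mul_le_mul_of_nonneg_left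
        (Real.exp_le_exp.2 (neg_le_neg hexp)) (by positivity)))).trans (le_of_eq ?_)
  have hsplit : -(c ^ 2 * √(n : ℝ) - 2 - Real.log (2 * n * (n + 1))) =
      Real.log (2 * n * (n + 1)) + -(c ^ 2 * √(n : ℝ) - 2) := by ring
  rw [hsplit, Real.exp_add, Real.exp_log (by positivity),
    ENNReal.ofReal_mul (by positivity), ENNReal.ofReal_mul (by positivity),
    ENNReal.ofReal_mul (by positivity), ENNReal.ofReal_mul (by positivity),
    ENNReal.ofReal_mul (by positivity)]
  simp only [ENNReal.ofReal_natCast, ENNReal.ofReal_ofNat]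
  ring
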